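/- Let $\Delta_r=\{z\in\mathbb C:|z|\le r\}$ and $\Delta=\Delta_1$. For an entire function $f$ and an integer $n\ge 0$ let $\mathcal P_n(f)$ be the set of polynomials $P\in\mathbb C[z,w]$ of (total) degree at most $n$ with $|P(z,f(z))|\le 1$ for all $z\in\Delta$, and put $$m_n(r)=\sup_{P\in\mathcal P_n(f)}\log\max_{z\in\Delta_r}|P(z,f(z))|,\qquad W_n(z)=\sup_{P\in\mathcal P_n(f)}\log|P(z,f(z))|,$$ $$W(z)=\limsup_{n\to\infty}\frac{W_n(z)}{n^2},\qquad W^\star(z)=\limsup_{\zeta\to z}W(\zeta),$$ where in the last limsup $\zeta=z$ is allowed, so that $W^\star$ is the upper semicontinuous regularization of $W$. (i) Let $f$ be an entire transcendental function, and suppose that there are a constant $C_f$ and a sequence $r_n$ increasing to infinity such that $m_n(r)\le C_f\,n^2\log r$ for all $n\ge1$ and $1\le r\le r_n$. Then $W^\star$ is a non-negative subharmonic function on $\mathbb C$, $W^\star\equiv0$ on $\Delta$, and for all $r\ge1$ $$\tfrac12\log r\le\max\{W^\star(z):|z|=r\}\le C_f\log r.$$ (ii) If $f(z)=e^z$, then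 $W^\star(z)=\tfrac12\log^+|z|$ for all $z\in\mathbb C$. -/

import Mathlib

open MeasureTheory Filter Topology Metric

noncomputable section

namespace TransMeasure

/-- The restriction `z ↦ P(z, f z)` of a polynomial `P(z, w)` to the graph of `f`. -/
def alongGraph (f : ℂ → ℂ) (P : MvPolynomial (Fin 2) ℂ) (z : ℂ) : ℂ :=
  MvPolynomial.eval ![z, f z] P

/-- An entire transcendental function: `P(z, f z)` vanishes identically only for `P = 0`. -/
structure IsEntireTranscendental (f : ℂ → ℂ) : Prop where
  entire : Differentiable ℂ f
  transcendental : ∀ P : MvPolynomial (Fin 2) ℂ, (∀ z, alongGraph f P z = 0) → P = 0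

/-- The uniform norm of `F` on the closed disk `{|z| ≤ r}`, with values in `[0, ∞]`. -/
def diskNorm (F : ℂ → ℂ) (r : ℝ) : ENNReal :=
  ⨆ z ∈ closedBall (0 : ℂ) r, ‖F z‖ₑ

/-- The polynomials `P(z, w)` of total degree at most `n` with `|P(z, f z)| ≤ 1` on the closed
unit disk. -/
def unitPolys (f : ℂ → ℂ) (n : ℕ) : Set (MvPolynomial (Fin 2) ℂ) :=
  {P | P.totalDegree ≤ n ∧ diskNorm (alongGraph f P) 1 ≤ 1}

/-- `m_n(r, f)`, with values in the extended reals (where `log 0 = -∞`). -/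
def growth (f : ℂ → ℂ) (n : ℕ) (r : ℝ) : EReal :=
  ⨆ P ∈ unitPolys f n, ENNReal.log (diskNorm (alongGraph f P) r)

/-- `W_n(z)`, the supremum of `log |P(z, f z)|`, with values in the extended reals. -/
def extremalN (f : ℂ → ℂ) (n : ℕ) (z : ℂ) : EReal :=
  ⨆ P ∈ unitPolys f n, ENNReal.log ‖alongGraph f P z‖ₑ

/-- `W(z) = limsup W_n(z) / n²`. -/
def extremal (f : ℂ → ℂ) (z : ℂ) : EReal :=
  limsup (fun n : ℕ => extremalN f n z / (((n : ℝ) ^ 2 : ℝ) : EReal)) atTop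

/-- The upper semicontinuous regularization `u*(z) = limsup_{ζ → z} u(ζ)`; the filter `𝓝 z`
includes the point `z` itself. -/
def uscReg (u : ℂ → EReal) (z : ℂ) : EReal :=
  limsup u (𝓝 z)

/-- The extremal function `W*`. -/
def extremalStar (f : ℂ → ℂ) : ℂ → EReal :=
  uscReg (extremal f)

/-- The mean `(1 / 2π) ∫₀^{2π} u(c + R e^{iθ}) dθ` of an extended real valued function, as the
integral of the positive part minus the integral of the negative part. -/
def circleMean (u : ℂ → EReal) (c : ℂ) (R : ℝ) : EReal :=
  (((∫⁻ θ in Set.Ioc 0 (2 * Real.pi), (u (circleMap c R θ)).toENNReal : ENNReal) : EReal)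
    - ((∫⁻ θ in Set.Ioc 0 (2 * Real.pi), (-u (circleMap c R θ)).toENNReal : ENNReal) : EReal))
    / ((2 * Real.pi : ℝ) : EReal)

/-- Subharmonic functions on the whole plane: upper semicontinuous with values in `[-∞, ∞)`,
and at most the mean over every circle at its centre. -/
structure IsSubharmonic (u : ℂ → EReal) : Prop where
  usc : UpperSemicontinuous u
  ne_top : ∀ z, u z ≠ ⊤
  submean : ∀ (c : ℂ) (R : ℝ), 0 < R → u c ≤ circleMean u c R

end TransMeasure

end

open scoped ENNReal

namespace TransMeasure

/-! The constant polynomial 1 is admissible, so every W_n is non-negative and each logarithm may be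
replaced by its positive part. Everything then takes place among functions with values in [0, ∞]
satisfying `SubMean`, where integrals always make sense.

Subharmonicity: Jensen's formula gives the inequality for log⁺|F|; it passes to suprema, to upper
limits of locally bounded sequences (reverse Fatou), and to the upper semicontinuous regularization.

Lower bound: there are N = (n+1)(n+2)/2 monomials of degree at most n, so some P ≠ 0 vanishes along
the graph at 0 to order M = N - 1 ≥ n²/2. Transcendence lets it be normalized on the unit disk, and
the Schwarz lemma makes it at least r^M at some point of |z| = r. That point depends on n, so
pointwise upper limits do not see it; Hartogs' lemma (`eventually_forall_le_of_isCompact`) transfers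
the bound to W*. The upper bound in (i) comes directly from the growth hypothesis.

For exp, P(z, e^z) solves a linear differential equation with constant coefficients of order N and
characteristic roots 0, …, n. Iterated variation of constants, with Cauchy estimates at 0, bounds it
by e^{n(r+1)} N r^N. Only r^N counts on the scale n², so W* ≤ ½ log⁺|z|. By the lower bound equality
holds somewhere on each circle of radius r > 1, and the strong maximum principle
(`eq_log_norm_of_eq`) spreads it over the exterior of the disk. -/

/-! ### Sub-mean value inequality: Jensen, suprema, upper limits, regularization -/

/-- The sub-mean value inequality on all circles for functions with values in `[0, ∞]`. -/
def SubMean (u : ℂ → ℝ≥0∞) : Prop :=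
  ∀ (c : ℂ) (R : ℝ), R ≠ 0 →
    ENNReal.ofReal (2 * Real.pi) * u c ≤
      ∫⁻ θ in Set.Ioc 0 (2 * Real.pi), u (circleMap c R θ)

lemma ofReal_setIntegral_le {g : ℝ → ℝ} {s : Set ℝ} (hg : IntegrableOn g s) :
    ENNReal.ofReal (∫ θ in s, g θ) ≤ ∫⁻ θ in s, ENNReal.ofReal (g θ) := by
  have h1 : ∫ θ in s, g θ ≤ ∫ θ in s, max (g θ) 0 :=
    integral_mono hg hg.pos_part fun θ => le_max_left _ _
  refine (ENNReal.ofReal_le_ofReal h1).trans ?_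
  rw [ofReal_integral_eq_lintegral_ofReal hg.pos_part
    (Eventually.of_forall fun θ => le_max_right _ _)]
  refine lintegral_mono fun θ => ?_
  rcases le_total (g θ) 0 with h | h
  · simp [h]
  · simp [h]

/-- By Jensen's formula the circle mean of log|F| exceeds log|F c| by a sum over the zeros u in the
disk, whose terms are non-negative because |c - u| ≤ |R|. If F c = 0 the left side is 0, since
`Real.log 0 = 0`. -/
lemma subMean_log_norm {F : ℂ → ℂ} (hF : Differentiable ℂ F) :
    SubMean fun z => ENNReal.ofReal (Real.log ‖F z‖) := by
  intro c R hR
  by_cases hc : F c = 0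
  · simp [hc]
  have han : AnalyticOnNhd ℂ F (closedBall c |R|) := fun z _ => hF.analyticAt z
  have hJ := han.circleAverage_log_norm hR hc
  have hsum : 0 ≤ ∑ᶠ u, (MeromorphicOn.divisor F (closedBall c |R|) u : ℝ) *
      Real.log (R * ‖c - u‖⁻¹) := by
    refine finsum_nonneg fun u => ?_
    by_cases hu : u ∈ closedBall c |R|
    · by_cases huc : u = c
      · simp [huc, MeromorphicOn.AnalyticOnNhd.divisor_apply han (mem_closedBall_self (abs_nonneg R)),
          (han c (mem_closedBall_self (abs_nonneg R))).analyticOrderAt_eq_zero.mpr hc]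
      · refine mul_nonneg (mod_cast MeromorphicOn.AnalyticOnNhd.divisor_nonneg han _) ?_
        rw [← Real.log_abs]
        apply Real.log_nonneg
        have h0 : 0 < ‖c - u‖ := by simpa [sub_eq_zero] using Ne.symm huc
        rw [mem_closedBall, dist_comm, dist_eq_norm] at hu
        rw [abs_mul, abs_inv, abs_norm, ← div_eq_mul_inv, one_le_div h0]
        exact hu
    · simp [hu]
  have hint : CircleIntegrable (fun z => Real.log ‖F z‖) c R :=
    MeromorphicOn.circleIntegrable_log_norm fun z _ => (hF.analyticAt z).meromorphicAt
  have hpi : (0 : ℝ) ≤ 2 * Real.pi := by positivity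
  have hint' : IntegrableOn (fun θ => Real.log ‖F (circleMap c R θ)‖)
      (Set.Ioc 0 (2 * Real.pi)) :=
    (intervalIntegrable_iff_integrableOn_Ioc_of_le hpi).1 hint
  rw [← ENNReal.ofReal_mul hpi]
  refine le_trans (ENNReal.ofReal_le_ofReal ?_) (ofReal_setIntegral_le hint')
  rw [← intervalIntegral.integral_of_le hpi]
  have h2 : Real.log ‖F c‖ ≤ Real.circleAverage (fun z => Real.log ‖F z‖) c R := by
    rw [hJ]; linarith
  rw [Real.circleAverage_def, smul_eq_mul, inv_mul_eq_div, le_div_iff₀ (by positivity)] at h2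
  linarith

lemma SubMean.iSup {ι : Sort*} {u : ι → ℂ → ℝ≥0∞} (hu : ∀ i, SubMean (u i)) :
    SubMean fun z => ⨆ i, u i z := by
  intro c R hR
  rw [ENNReal.mul_iSup]
  exact iSup_le fun i => (hu i c R hR).trans
    (lintegral_mono fun θ => le_iSup (fun i => u i (circleMap c R θ)) i)

lemma SubMean.const_mul {u : ℂ → ℝ≥0∞} (hu : SubMean u) {a : ℝ≥0∞} (ha : a ≠ ∞) :
    SubMean fun z => a * u z := by
  intro c R hR
  rw [lintegral_const_mul' _ _ ha, mul_left_comm]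
  gcongr
  exact hu c R hR

/-- Reverse Fatou under a constant bound that need only hold from some index on, obtained by
shifting the sequence. -/
lemma limsup_lintegral_le_of_eventually {α : Type*} [MeasurableSpace α] {μ : Measure α}
    [IsFiniteMeasure μ] {g : ℕ → α → ℝ≥0∞} (hg : ∀ n, Measurable (g n)) {B : ℝ≥0∞}
    (hB : B ≠ ∞) (h : ∀ᶠ n in atTop, ∀ᵐ x ∂μ, g n x ≤ B) :
    limsup (fun n => ∫⁻ x, g n x ∂μ) atTop ≤ ∫⁻ x, limsup (fun n => g n x) atTop ∂μ := by
  obtain ⟨N, hN⟩ := eventually_atTop.1 h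
  have := limsup_lintegral_le (μ := μ) (f := fun n => g (n + N)) (fun _ => B)
    (fun n => hg _) (fun n => hN _ (Nat.le_add_left _ _)) (by
      simpa using ENNReal.mul_ne_top hB (measure_ne_top μ _))
  rw [limsup_nat_add (fun n => ∫⁻ x, g n x ∂μ) N] at this
  refine this.trans (le_of_eq (lintegral_congr fun x => ?_))
  exact limsup_nat_add (fun n => g n x) N

/-- Local uniform boundedness above, from some index on, of a sequence of functions. -/
def EventuallyLocallyBounded (u : ℕ → ℂ → ℝ≥0∞) : Prop :=
  ∀ R : ℝ, ∃ B : ℝ≥0∞, B ≠ ∞ ∧ ∀ᶠ n in atTop, ∀ z ∈ closedBall (0 : ℂ) R, u n z ≤ B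

lemma circleMap_mem_closedBall_zero (c : ℂ) (R θ : ℝ) :
    circleMap c R θ ∈ closedBall (0 : ℂ) (‖c‖ + |R|) := by
  rw [mem_closedBall_zero_iff, circleMap]
  refine (norm_add_le _ _).trans ?_
  simp

lemma subMean_limsup {u : ℕ → ℂ → ℝ≥0∞} (hu : ∀ n, SubMean (u n))
    (hm : ∀ n, Measurable (u n)) (hb : EventuallyLocallyBounded u) :
    SubMean fun z => limsup (fun n => u n z) atTop := by
  intro c R hR
  obtain ⟨B, hB, hev⟩ := hb (‖c‖ + |R|)
  have hmc : Measurable (circleMap c R) := (continuous_circleMap c R).measurable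
  have h1 := limsup_lintegral_le_of_eventually
    (μ := volume.restrict (Set.Ioc 0 (2 * Real.pi)))
    (g := fun n θ => u n (circleMap c R θ)) (fun n => (hm n).comp hmc) hB
    (hev.mono fun n hn => Eventually.of_forall fun θ =>
      hn _ (circleMap_mem_closedBall_zero c R θ))
  refine le_trans ?_ h1
  rw [← ENNReal.limsup_const_mul_of_ne_top ENNReal.ofReal_ne_top]
  exact limsup_le_limsup (Eventually.of_forall fun n => hu n c R hR)

lemma upperSemicontinuous_limsup_nhds {γ : Type*} [CompleteLinearOrder γ] [DenselyOrdered γ]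
    (u : ℂ → γ) : UpperSemicontinuous fun z => limsup u (𝓝 z) := by
  intro z a hza
  obtain ⟨b, hb1, hb2⟩ := exists_between hza
  have h := eventually_eventually_nhds.2 (eventually_lt_of_limsup_lt hb1)
  filter_upwards [h] with w hw
  exact (limsup_le_of_le (h := hw.mono fun _ h => h.le)).trans_lt hb2

lemma le_limsup_nhds_self {γ : Type*} [CompleteLinearOrder γ] (u : ℂ → γ) (z : ℂ) :
    u z ≤ limsup u (𝓝 z) := by
  refine le_limsup_of_frequently_le ?_
  exact fun h => h.self_of_nhds le_rfl

/-- If the inequality failed at c, some a would lie strictly between the mean of the regularization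
v over the circle and v c. Points x n → c with w (x n) > a have circle means of v at least a; by
reverse Fatou and upper semicontinuity of v these cannot exceed the mean over the circle at c in the
limit. -/
lemma subMean_limsup_nhds {w : ℂ → ℝ≥0∞} (hw : SubMean w)
    (hb : ∀ R : ℝ, ∃ B : ℝ≥0∞, B ≠ ∞ ∧ ∀ z ∈ closedBall (0 : ℂ) R, w z ≤ B) :
    SubMean fun z => limsup w (𝓝 z) := by
  intro c R hR
  set v : ℂ → ℝ≥0∞ := fun z => Filter.limsup w (𝓝 z) with hv
  have hvusc : UpperSemicontinuous v := upperSemicontinuous_limsup_nhds w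
  have hmv : Measurable v := hvusc.measurable
  by_contra! hlt
  set I := ∫⁻ θ in Set.Ioc 0 (2 * Real.pi), v (circleMap c R θ) with hI
  set k := ENNReal.ofReal (2 * Real.pi) with hk
  have hk0 : k ≠ 0 := by simp [hk, Real.pi_pos]
  have hkt : k ≠ ∞ := ENNReal.ofReal_ne_top
  have hlt' : I / k < Filter.limsup w (𝓝 c) := by
    rw [ENNReal.div_lt_iff (Or.inl hk0) (Or.inl hkt), mul_comm]; exact hlt
  obtain ⟨a, ha1, ha2⟩ := exists_between hlt'
  obtain ⟨x, hxt, hx⟩ := exists_seq_forall_of_frequently (frequently_lt_of_lt_limsup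
    (by isBoundedDefault) ha2)
  -- One unit of room is for the moving centres `x n`, the other for the neighbourhoods in which v
  -- is an upper limit of w.
  obtain ⟨B, hB, hBw⟩ := hb (‖c‖ + 1 + |R| + 1)
  have hvB : ∀ z ∈ closedBall (0 : ℂ) (‖c‖ + 1 + |R|), v z ≤ B := by
    intro z hz
    refine limsup_le_of_le (h := ?_)
    filter_upwards [ball_mem_nhds z one_pos] with y hy
    refine hBw y ?_
    rw [mem_closedBall_zero_iff] at hz ⊢
    have := norm_sub_norm_le y z
    rw [mem_ball, dist_eq_norm] at hy
    linarith
  have hev : ∀ᶠ n in atTop, ‖x n‖ ≤ ‖c‖ + 1 := by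
    have := hxt.norm.eventually (gt_mem_nhds (show ‖c‖ < ‖c‖ + 1 by linarith))
    exact this.mono fun n hn => le_of_lt hn
  have h1 := limsup_lintegral_le_of_eventually
    (μ := volume.restrict (Set.Ioc 0 (2 * Real.pi)))
    (g := fun n θ => v (circleMap (x n) R θ))
    (fun n => hmv.comp (continuous_circleMap (x n) R).measurable) hB
    (hev.mono fun n hn => Eventually.of_forall fun θ => hvB _ (by
      have := circleMap_mem_closedBall_zero (x n) R θ
      rw [mem_closedBall_zero_iff] at this ⊢
      linarith))
  have h2 : k * a ≤ Filter.limsup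
      (fun n => ∫⁻ θ in Set.Ioc 0 (2 * Real.pi), v (circleMap (x n) R θ)) atTop := by
    refine le_limsup_of_frequently_le (Eventually.frequently (Eventually.of_forall fun n => ?_))
    refine le_trans ?_ ((hw (x n) R hR).trans
      (lintegral_mono fun θ => le_limsup_nhds_self w _))
    gcongr
    exact (hx n).le
  have h3 : ∫⁻ θ in Set.Ioc 0 (2 * Real.pi),
      Filter.limsup (fun n => v (circleMap (x n) R θ)) atTop ≤ I := by
    refine lintegral_mono fun θ => ?_
    have ht : Tendsto (fun n => circleMap (x n) R θ) atTop (𝓝 (circleMap c R θ)) := by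
      simp only [circleMap]
      exact hxt.add_const _
    refine le_of_forall_gt_imp_ge_of_dense fun b hb => ?_
    refine limsup_le_of_le (h := ?_)
    exact (ht.eventually (hvusc _ b hb)).mono fun n hn => hn.le
  have h4 : k * a ≤ I := h2.trans (h1.trans h3)
  rw [ENNReal.div_lt_iff (Or.inl hk0) (Or.inl hkt), mul_comm] at ha1
  exact absurd h4 (not_le.2 ha1)

/-! ### Area means and Hartogs' lemma -/

lemma SubMean.le_lintegral_Ioo {u : ℂ → ℝ≥0∞} (hu : SubMean u) (c : ℂ) {R : ℝ} (hR : R ≠ 0) :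
    ENNReal.ofReal (2 * Real.pi) * u c ≤
      ∫⁻ θ in Set.Ioo (-Real.pi) Real.pi, u (circleMap c R θ) := by
  -- Radius -R is radius R with the angle shifted by π, which moves (0, 2π] to the interval (-π, π]
  -- of polar coordinates.
  refine (hu c (-R) (neg_ne_zero.2 hR)).trans (le_of_eq ?_)
  rw [setLIntegral_congr Ioo_ae_eq_Ioc, ← lintegral_indicator measurableSet_Ioc,
    ← lintegral_indicator measurableSet_Ioc, ← lintegral_add_right_eq_self _ Real.pi]
  refine lintegral_congr fun θ => ?_
  have hmem : θ + Real.pi ∈ Set.Ioc 0 (2 * Real.pi) ↔ θ ∈ Set.Ioc (-Real.pi) Real.pi := by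
    simp only [Set.mem_Ioc]
    constructor <;> rintro ⟨h1, h2⟩ <;> constructor <;> linarith
  have hpt : circleMap c (-R) (θ + Real.pi) = circleMap c R θ := by
    simp [circleMap, add_mul, Complex.exp_add]
  simp only [Set.indicator, hmem, hpt]

lemma lintegral_Ioo_ofReal {δ : ℝ} (hδ : 0 < δ) :
    ∫⁻ r in Set.Ioo 0 δ, ENNReal.ofReal r = ENNReal.ofReal (δ ^ 2 / 2) := by
  rw [setLIntegral_congr Ioo_ae_eq_Ioc, ← ofReal_integral_eq_lintegral_ofReal,
    ← intervalIntegral.integral_of_le hδ.le]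
  · simp
  · exact (intervalIntegrable_iff_integrableOn_Ioc_of_le hδ.le).1
      (continuous_id.intervalIntegrable _ _)
  · exact (ae_restrict_iff' measurableSet_Ioc).2 (Eventually.of_forall fun x hx => hx.1.le)

/-- The area form of the sub-mean value inequality. -/
lemma SubMean.le_lintegral_ball {u : ℂ → ℝ≥0∞} (hu : SubMean u) (hm : Measurable u) (c : ℂ)
    {δ : ℝ} (hδ : 0 < δ) :
    ENNReal.ofReal (Real.pi * δ ^ 2) * u c ≤ ∫⁻ z in ball c δ, u z := by
  set g : ℂ → ℝ≥0∞ := fun z => (ball c δ).indicator u (c + z) with hg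
  have hmg : Measurable g :=
    (hm.indicator measurableSet_ball).comp (measurable_const_add c)
  have h1 : ∫⁻ z in ball c δ, u z = ∫⁻ z, g z := by
    rw [← lintegral_indicator measurableSet_ball, hg]
    exact (lintegral_add_left_eq_self _ c).symm
  have hsymm : ∀ p : ℝ × ℝ, c + Complex.polarCoord.symm p = circleMap c p.1 p.2 := fun p => by
    rw [Complex.polarCoord_symm_apply, circleMap, Complex.exp_mul_I]; simp
  have hmp : Measurable fun p : ℝ × ℝ => ENNReal.ofReal p.1 * u (circleMap c p.1 p.2) := by
    refine (ENNReal.measurable_ofReal.comp measurable_fst).mul (hm.comp ?_)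
    unfold circleMap
    fun_prop
  rw [h1, ← Complex.lintegral_comp_polarCoord_symm g]
  have hsub : Set.Ioo 0 δ ×ˢ Set.Ioo (-Real.pi) Real.pi ⊆ polarCoord.target := by
    rintro ⟨r, θ⟩ ⟨h1, h2⟩
    exact ⟨h1.1, h2⟩
  refine le_trans ?_ (lintegral_mono_set hsub)
  have h2 : ∫⁻ p in Set.Ioo 0 δ ×ˢ Set.Ioo (-Real.pi) Real.pi,
      ENNReal.ofReal p.1 • g (Complex.polarCoord.symm p) =
      ∫⁻ p in Set.Ioo 0 δ ×ˢ Set.Ioo (-Real.pi) Real.pi,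
        ENNReal.ofReal p.1 * u (circleMap c p.1 p.2) := by
    refine setLIntegral_congr_fun (measurableSet_Ioo.prod measurableSet_Ioo) fun p hp => ?_
    simp only [hg, hsymm, smul_eq_mul]
    rw [Set.indicator_of_mem]
    rw [mem_ball, dist_eq_norm, circleMap_sub_center]
    simp [abs_of_pos hp.1.1, hp.1.2]
  rw [h2, Measure.volume_eq_prod, ← Measure.prod_restrict,
    lintegral_prod _ hmp.aemeasurable]
  have h3 : ENNReal.ofReal (Real.pi * δ ^ 2) * u c =
      ∫⁻ r in Set.Ioo 0 δ, ENNReal.ofReal r * (ENNReal.ofReal (2 * Real.pi) * u c) := by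
    rw [lintegral_mul_const _ ENNReal.measurable_ofReal, lintegral_Ioo_ofReal hδ, ← mul_assoc,
      ← ENNReal.ofReal_mul (by positivity)]
    congr 2
    ring
  rw [h3]
  refine setLIntegral_mono' measurableSet_Ioo fun r hr => ?_
  rw [lintegral_const_mul' _ _ ENNReal.ofReal_ne_top]
  gcongr
  exact hu.le_lintegral_Ioo c hr.1.ne'

lemma volume_ball_eq_ofReal (c : ℂ) {δ : ℝ} (hδ : 0 < δ) :
    volume (ball c δ) = ENNReal.ofReal (Real.pi * δ ^ 2) := by
  rw [Complex.volume_ball, mul_comm Real.pi, ENNReal.ofReal_mul (by positivity),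
    ENNReal.ofReal_pow hδ.le]
  congr 1
  rw [← ENNReal.ofReal_coe_nnreal, NNReal.coe_real_pi]

/-- Hartogs' lemma, local form: if the regularized upper limit of a locally bounded sequence of
functions with the sub-mean value property is below `A` at `z₀`, then the functions are eventually
at most `A` in a neighbourhood of `z₀`. -/
lemma eventually_le_of_limsup_nhds_lt {u : ℕ → ℂ → ℝ≥0∞} (hu : ∀ n, SubMean (u n))
    (hm : ∀ n, Measurable (u n)) (hb : EventuallyLocallyBounded u) {z₀ : ℂ} {A : ℝ≥0∞}
    (hA : limsup (fun z => limsup (fun n => u n z) atTop) (𝓝 z₀) < A) :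
    ∀ᶠ p : ℕ × ℂ in atTop ×ˢ 𝓝 z₀, u p.1 p.2 ≤ A := by
  rcases eq_or_ne A ∞ with rfl | hAt
  · exact Eventually.of_forall fun _ => le_top
  obtain ⟨a, ha1, ha2⟩ := exists_between hA
  obtain ⟨a', ha3, ha4⟩ := exists_between ha2
  have hev := eventually_lt_of_limsup_lt ha1
  obtain ⟨δ, hδ, hball⟩ := Metric.eventually_nhds_iff_ball.1 hev
  have hat' : a' ≠ ∞ := (ha4.trans_le le_top).ne
  have hapos : 0 < a'.toReal := ENNReal.toReal_pos (pos_of_gt ha3).ne' hat'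
  have hAlt : a'.toReal < A.toReal := (ENNReal.toReal_lt_toReal hat' hAt).2 ha4
  have hApos : 0 < A.toReal := hapos.trans hAlt
  -- With A t² = a', the area bound a' on the disk of radius δ about z₀ becomes exactly the bound A
  -- on a disk of radius tδ. Such a disk stays inside the first when its centre is within (1 - t)δ
  -- of z₀.
  set t : ℝ := Real.sqrt (a'.toReal / A.toReal) with ht
  have ht0 : 0 < t := Real.sqrt_pos.2 (by positivity)
  have ht1 : t < 1 := by
    rw [ht, Real.sqrt_lt' one_pos, one_pow, div_lt_one hApos]; exact hAlt
  have ht2 : A.toReal * t ^ 2 = a'.toReal := by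
    rw [ht, Real.sq_sqrt (by positivity)]; field_simp
  have hV : volume (ball z₀ δ) = ENNReal.ofReal (Real.pi * δ ^ 2) := volume_ball_eq_ofReal z₀ hδ
  have hV0 : volume (ball z₀ δ) ≠ 0 := (measure_ball_pos _ _ hδ).ne'
  have hVt : volume (ball z₀ δ) ≠ ∞ := measure_ball_lt_top.ne
  have : IsFiniteMeasure (volume.restrict (ball z₀ δ)) :=
    ⟨by rw [Measure.restrict_apply_univ]; exact measure_ball_lt_top⟩
  obtain ⟨B, hB, hBev⟩ := hb (‖z₀‖ + δ)
  have h1 := limsup_lintegral_le_of_eventually (μ := volume.restrict (ball z₀ δ)) hm hB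
    (hBev.mono fun n hn => (ae_restrict_iff' measurableSet_ball).2 (Eventually.of_forall
      fun z hz => hn z (by
        rw [mem_closedBall_zero_iff]
        rw [mem_ball, dist_eq_norm] at hz
        have := norm_sub_norm_le z z₀
        linarith)))
  have h2 : ∫⁻ z in ball z₀ δ, limsup (fun n => u n z) atTop ≤ a * volume (ball z₀ δ) := by
    refine (setLIntegral_mono' (g := fun _ => a) measurableSet_ball
      fun z hz => (hball z hz).le).trans ?_
    rw [setLIntegral_const]
  have h3 : a * volume (ball z₀ δ) < a' * volume (ball z₀ δ) :=
    ENNReal.mul_lt_mul_left hV0 hVt ha3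
  have h4 := eventually_lt_of_limsup_lt ((h1.trans h2).trans_lt h3)
  have hη : 0 < (1 - t) * δ := mul_pos (by linarith) hδ
  refine (h4.prod_mk (ball_mem_nhds z₀ hη)).mono ?_
  rintro ⟨n, z⟩ ⟨hn, hz⟩
  simp only at hn hz ⊢
  have hsub : ball z (t * δ) ⊆ ball z₀ δ := by
    refine ball_subset_ball' ?_
    have : dist z z₀ < (1 - t) * δ := hz
    linarith
  have h5 := (hu n).le_lintegral_ball (hm n) z (mul_pos ht0 hδ)
  have h6 := (h5.trans (lintegral_mono_set hsub)).trans hn.le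
  have h7 : a' * volume (ball z₀ δ) = ENNReal.ofReal (Real.pi * (t * δ) ^ 2) * A := by
    rw [hV, ← ENNReal.ofReal_toReal hat', ← ENNReal.ofReal_toReal hAt,
      ← ENNReal.ofReal_mul (by positivity), ← ENNReal.ofReal_mul (by positivity), ← ht2]
    congr 1
    ring
  rw [h7] at h6
  exact (ENNReal.mul_le_mul_iff_right (by
    rw [ne_eq, ENNReal.ofReal_eq_zero, not_le]; positivity) ENNReal.ofReal_ne_top).1 h6

lemma eventually_forall_le_of_isCompact {u : ℕ → ℂ → ℝ≥0∞} (hu : ∀ n, SubMean (u n))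
    (hm : ∀ n, Measurable (u n)) (hb : EventuallyLocallyBounded u) {K : Set ℂ}
    (hK : IsCompact K) {A : ℝ≥0∞}
    (hA : ∀ z ∈ K, limsup (fun z => limsup (fun n => u n z) atTop) (𝓝 z) < A) :
    ∀ᶠ n in atTop, ∀ z ∈ K, u n z ≤ A := by
  have h : ∀ᶠ p : ℕ × ℂ in atTop ×ˢ 𝓝ˢ K, u p.1 p.2 ≤ A := by
    rw [hK.prod_nhdsSet_eq_biSup]
    simp only [eventually_iSup]
    exact fun z hz => eventually_le_of_limsup_nhds_lt hu hm hb (hA z hz)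
  exact h.curry.mono fun n hn => hn.self_of_nhdsSet

/-! ### Strong maximum principle outside the unit disk -/

lemma isPreconnected_one_lt_norm : IsPreconnected {z : ℂ | 1 < ‖z‖} := by
  have h : {z : ℂ | 1 < ‖z‖} = Complex.exp '' {w : ℂ | 0 < w.re} := by
    ext z
    constructor
    · intro hz
      refine ⟨Complex.log z, ?_, Complex.exp_log ?_⟩
      · change 0 < (Complex.log z).re
        rw [Complex.log_re]
        exact Real.log_pos hz
      have hz' : 1 < ‖z‖ := hz
      rw [← norm_pos_iff]; linarith
    · rintro ⟨w, hw, rfl⟩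
      change 1 < ‖Complex.exp w‖
      rw [Complex.norm_exp]
      exact Real.one_lt_exp_iff.2 hw
  rw [h]
  exact (convex_halfSpace_re_gt 0).isPreconnected.image _ Complex.continuous_exp.continuousOn

/-- Strong maximum principle for the comparison with `a * log ‖z‖` outside the unit disk: a point
of contact on a circle forces contact on the circle. -/
lemma eq_log_norm_on_circle {v : ℂ → ℝ≥0∞} (hv : SubMean v) (husc : UpperSemicontinuous v)
    {a : ℝ} (ha : 0 ≤ a) (hle : ∀ z : ℂ, 1 < ‖z‖ → v z ≤ ENNReal.ofReal (a * Real.log ‖z‖))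
    {c : ℂ} (hc : v c = ENNReal.ofReal (a * Real.log ‖c‖)) {R : ℝ} (hR : 0 < R)
    (hRc : R < ‖c‖ - 1) {z : ℂ} (hz : z ∈ sphere c R) :
    v z = ENNReal.ofReal (a * Real.log ‖z‖) := by
  have hbig : ∀ w ∈ closedBall c R, 1 < ‖w‖ := by
    intro w hw
    rw [mem_closedBall, dist_eq_norm] at hw
    have := norm_sub_norm_le c w
    rw [norm_sub_rev] at this
    linarith
  have hcirc : ∀ θ, circleMap c R θ ∈ closedBall c R := fun θ =>
    circleMap_mem_closedBall c hR.le θ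
  set l : ℝ → ℝ := fun θ => a * Real.log ‖circleMap c R θ‖ with hl
  have hlc : Continuous l := by
    refine continuous_const.mul (Continuous.log (continuous_circleMap c R).norm fun θ => ?_)
    linarith [hbig _ (hcirc θ)]
  have hlc' : Continuous fun θ => ENNReal.ofReal (l θ) := ENNReal.continuous_ofReal.comp hlc
  have hl0 : ∀ θ, 0 ≤ l θ := fun θ => mul_nonneg ha (Real.log_nonneg (hbig _ (hcirc θ)).le)
  have hpi : (0 : ℝ) ≤ 2 * Real.pi := by positivity
  have hlint : IntegrableOn l (Set.Ioc 0 (2 * Real.pi)) :=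
    (intervalIntegrable_iff_integrableOn_Ioc_of_le hpi).1 (hlc.intervalIntegrable _ _)
  -- log‖z‖ is harmonic near the closed disk about c, so the comparison function has mean exactly v
  -- c. Domination and the sub-mean inequality then force equality almost everywhere on the circle.
  have hint : ∫⁻ θ in Set.Ioc 0 (2 * Real.pi), ENNReal.ofReal (l θ) =
      ENNReal.ofReal (2 * Real.pi) * v c := by
    rw [← ofReal_integral_eq_lintegral_ofReal hlint (Eventually.of_forall hl0), hc,
      ← ENNReal.ofReal_mul hpi, ← intervalIntegral.integral_of_le hpi]
    congr 1
    have hJ : Real.circleAverage (fun z => Real.log ‖id z‖) c R = Real.log ‖c‖ :=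
      AnalyticOnNhd.circleAverage_log_norm_of_ne_zero (g := id)
        (fun z _ => analyticAt_id) fun w hw h0 => by
          have := hbig w (by rwa [abs_of_pos hR] at hw)
          rw [id_eq] at h0
          rw [h0, norm_zero] at this
          linarith
    rw [Real.circleAverage_def, smul_eq_mul, inv_mul_eq_div, div_eq_iff (by positivity)] at hJ
    simp only [hl, intervalIntegral.integral_const_mul]
    simp only [id_eq] at hJ
    rw [hJ]
    ring
  have hvle : ∀ θ, v (circleMap c R θ) ≤ ENNReal.ofReal (l θ) := fun θ => hle _ (hbig _ (hcirc θ))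
  have hae : (fun θ => v (circleMap c R θ)) =ᵐ[volume.restrict (Set.Ioc 0 (2 * Real.pi))]
      fun θ => ENNReal.ofReal (l θ) := by
    refine ae_eq_of_ae_le_of_lintegral_le (Eventually.of_forall hvle) ?_
      hlc'.measurable.aemeasurable ?_
    · refine ne_top_of_le_ne_top ?_ (lintegral_mono hvle)
      rw [hint, hc]
      exact ENNReal.mul_ne_top ENNReal.ofReal_ne_top ENNReal.ofReal_ne_top
    · rw [hint]
      exact hv c R hR.ne'
  -- By upper semicontinuity strict inequality is an open condition in θ, so being null it is empty;
  -- the closure argument below also covers the endpoint 2π.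
  set O : Set ℝ := {θ | v (circleMap c R θ) < ENNReal.ofReal (l θ)} with hO
  have hOo : IsOpen O := by
    rw [isOpen_iff_mem_nhds]
    intro θ hθ
    obtain ⟨b, hb1, hb2⟩ := exists_between (show v (circleMap c R θ) < ENNReal.ofReal (l θ) from hθ)
    have e1 : ∀ᶠ x in 𝓝 θ, v (circleMap c R x) < b :=
      (continuous_circleMap c R).continuousAt.eventually (husc _ b hb1)
    filter_upwards [e1, hlc'.continuousAt.eventually (lt_mem_nhds hb2)] with x h1 h2
    exact h1.trans h2
  have hnull : volume (O ∩ Set.Ioo 0 (2 * Real.pi)) = 0 := by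
    have h := (ae_restrict_iff' measurableSet_Ioc).1 hae
    refine measure_mono_null ?_ h
    rintro θ ⟨h1, h2⟩ h3
    exact absurd (h3 ⟨h2.1, h2.2.le⟩) (ne_of_lt h1)
  have hempty : O ∩ Set.Ioo 0 (2 * Real.pi) = ∅ :=
    (hOo.inter isOpen_Ioo).eq_empty_of_measure_zero hnull
  have hdisj : Disjoint O (Set.Icc 0 (2 * Real.pi)) := by
    rw [← closure_Ioo (by positivity : (0 : ℝ) ≠ 2 * Real.pi)]
    exact (Set.disjoint_iff_inter_eq_empty.2 hempty).closure_right hOo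
  have himg : z ∈ circleMap c R '' Set.Ioc 0 (2 * Real.pi) := by
    rw [image_circleMap_Ioc, abs_of_pos hR]; exact hz
  obtain ⟨θ, hθ, rfl⟩ := himg
  refine le_antisymm (hvle θ) ?_
  by_contra! hlt
  exact Set.disjoint_left.1 hdisj (show θ ∈ O from hlt) ⟨hθ.1.le, hθ.2⟩

/-- If `v` has the sub-mean value property, is upper semicontinuous, is at most `a * log ‖z‖`
outside the unit disk, and equality holds at one point there, then it holds everywhere there. -/
lemma eq_log_norm_of_eq {v : ℂ → ℝ≥0∞} (hv : SubMean v) (husc : UpperSemicontinuous v)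
    {a : ℝ} (ha : 0 ≤ a) (hle : ∀ z : ℂ, 1 < ‖z‖ → v z ≤ ENNReal.ofReal (a * Real.log ‖z‖))
    {c : ℂ} (hc1 : 1 < ‖c‖) (hc : v c = ENNReal.ofReal (a * Real.log ‖c‖))
    {z : ℂ} (hz : 1 < ‖z‖) :
    v z = ENNReal.ofReal (a * Real.log ‖z‖) := by
  have hcont : ∀ w : ℂ, 1 < ‖w‖ → ContinuousAt (fun w => ENNReal.ofReal (a * Real.log ‖w‖)) w :=
    fun w hw => ENNReal.continuous_ofReal.continuousAt.comp
      (continuousAt_const.mul (continuous_norm.continuousAt.log (by linarith)))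
  have hopen : IsOpen {w : ℂ | 1 < ‖w‖} := isOpen_lt continuous_const continuous_norm
  set S : Set ℂ := {w | 1 < ‖w‖ ∧ v w = ENNReal.ofReal (a * Real.log ‖w‖)} with hS
  set T : Set ℂ := {w | 1 < ‖w‖ ∧ v w < ENNReal.ofReal (a * Real.log ‖w‖)} with hT
  have hSo : IsOpen S := by
    rw [isOpen_iff_mem_nhds]
    rintro w ⟨hw1, hw2⟩
    have hpos : 0 < ‖w‖ - 1 := by linarith
    filter_upwards [ball_mem_nhds w hpos, hopen.mem_nhds hw1] with y hy hy1
    refine ⟨hy1, ?_⟩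
    rcases eq_or_ne y w with rfl | hyw
    · exact hw2
    -- Each y near w lies on the circle about w of radius |y - w| < |w| - 1.
    · exact eq_log_norm_on_circle hv husc ha hle hw2 (dist_pos.2 hyw) hy rfl
  have hTo : IsOpen T := by
    rw [isOpen_iff_mem_nhds]
    rintro w ⟨hw1, hw2⟩
    obtain ⟨b, hb1, hb2⟩ := exists_between hw2
    filter_upwards [husc w b hb1, (hcont w hw1).eventually (lt_mem_nhds hb2),
      hopen.mem_nhds hw1] with y h1 h2 h3
    exact ⟨h3, h1.trans h2⟩
  by_contra hne
  have hzT : z ∈ T := ⟨hz, lt_of_le_of_ne (hle z hz) hne⟩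
  obtain ⟨y, -, ⟨-, hy1⟩, -, hy2⟩ := isPreconnected_one_lt_norm S T hSo hTo
    (fun w hw => (hle w hw).eq_or_lt.imp (fun h => ⟨hw, h⟩) fun h => ⟨hw, h⟩)
    ⟨c, hc1, hc1, hc⟩ ⟨z, hz, hzT⟩
  exact hy2.ne hy1

/-! ### Polynomials vanishing to high order along the graph -/

lemma differentiable_alongGraph {f : ℂ → ℂ} (hf : Differentiable ℂ f)
    (P : MvPolynomial (Fin 2) ℂ) : Differentiable ℂ (alongGraph f P) := by
  have h : alongGraph f P = fun z => ∑ d ∈ P.support, P.coeff d * (z ^ d 0 * f z ^ d 1) := by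
    funext z
    simp [alongGraph, MvPolynomial.eval_eq', Fin.prod_univ_two]
  rw [h]
  fun_prop

lemma exists_pow_mul_of_order {F : ℂ → ℂ} (hF : Differentiable ℂ F) {M : ℕ}
    (h : ∀ k < M, iteratedDeriv k F 0 = 0) :
    ∃ g : ℂ → ℂ, Differentiable ℂ g ∧ ∀ z, F z = z ^ M * g z := by
  have han := hF.analyticAt 0
  obtain ⟨q, hq, hFq⟩ := (natCast_le_analyticOrderAt han).1
    ((natCast_le_analyticOrderAt_iff_iteratedDeriv_eq_zero han).2 h)
  simp only [sub_zero, smul_eq_mul] at hFq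
  set g : ℂ → ℂ := Function.update (fun z => F z / z ^ M) 0 (q 0) with hg
  have hgq : g =ᶠ[𝓝 0] q := by
    filter_upwards [hFq] with z hz
    rcases eq_or_ne z 0 with rfl | hz0
    · simp [hg]
    · rw [hg, Function.update_of_ne hz0, hz]
      field_simp
  refine ⟨g, fun z => ?_, fun z => ?_⟩
  · rcases eq_or_ne z 0 with rfl | hz0
    · exact hgq.differentiableAt_iff.2 hq.differentiableAt
    · have : g =ᶠ[𝓝 z] fun z => F z / z ^ M := by
        filter_upwards [isOpen_ne.mem_nhds hz0] with y hy
        rw [hg, Function.update_of_ne hy]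
      rw [this.differentiableAt_iff]
      exact hF.differentiableAt.div (by fun_prop) (pow_ne_zero _ hz0)
  · rcases eq_or_ne z 0 with rfl | hz0
    · rw [hFq.self_of_nhds, hgq.self_of_nhds]
    · rw [hg, Function.update_of_ne hz0]
      field_simp

/-- A Schwarz lemma: an entire function that vanishes at `0` to order `M` grows at least
like `r ^ M` from the unit disk to the circle of radius `r`. -/
lemma exists_mem_sphere_pow_mul_norm_le {F : ℂ → ℂ} (hF : Differentiable ℂ F) {M : ℕ}
    (h : ∀ k < M, iteratedDeriv k F 0 = 0) {r : ℝ} (hr : 1 ≤ r) :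
    ∃ z ∈ sphere (0 : ℂ) r, ∀ w ∈ closedBall (0 : ℂ) 1, r ^ M * ‖F w‖ ≤ ‖F z‖ := by
  obtain ⟨g, hg, hFg⟩ := exists_pow_mul_of_order hF h
  have hr0 : r ≠ 0 := by linarith
  obtain ⟨z, hz, hmax⟩ := Complex.exists_mem_frontier_isMaxOn_norm (isBounded_ball (x := (0 : ℂ))
    (r := r)) (nonempty_ball.2 (by linarith)) hg.diffContOnCl
  rw [frontier_ball _ hr0] at hz
  rw [closure_ball _ hr0] at hmax
  refine ⟨z, hz, fun w hw => ?_⟩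
  have h1 : ‖g w‖ ≤ ‖g z‖ := hmax (closedBall_subset_closedBall hr hw)
  rw [mem_sphere_zero_iff_norm] at hz
  rw [mem_closedBall_zero_iff] at hw
  rw [hFg w, hFg z, norm_mul, norm_mul, norm_pow, norm_pow, hz]
  have h2 : ‖w‖ ^ M * ‖g w‖ ≤ 1 * ‖g z‖ :=
    mul_le_mul (pow_le_one₀ (norm_nonneg _) hw) h1 (norm_nonneg _) zero_le_one
  rw [one_mul] at h2
  gcongr

/-- The exponents of the monomials of degree at most `n` in two variables. -/
abbrev MonomialIndex (n : ℕ) : Type := Σ a : Fin (n + 1), Fin (a + 1)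

/-- The exponent vector belonging to an index. -/
noncomputable def MonomialIndex.exponent {n : ℕ} (i : MonomialIndex n) : Fin 2 →₀ ℕ :=
  Finsupp.single 0 (i.2 : ℕ) + Finsupp.single 1 ((i.1 : ℕ) - i.2)

lemma MonomialIndex.exponent_zero {n : ℕ} (i : MonomialIndex n) : i.exponent 0 = i.2 := by
  simp [MonomialIndex.exponent]

lemma MonomialIndex.exponent_one {n : ℕ} (i : MonomialIndex n) :
    i.exponent 1 = (i.1 : ℕ) - i.2 := by
  simp [MonomialIndex.exponent]

lemma MonomialIndex.exponent_injective (n : ℕ) :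
    Function.Injective (MonomialIndex.exponent : MonomialIndex n → Fin 2 →₀ ℕ) := by
  rintro ⟨a, b⟩ ⟨a', b'⟩ h
  have h0 := DFunLike.congr_fun h 0
  have h1 := DFunLike.congr_fun h 1
  simp only [MonomialIndex.exponent_zero, MonomialIndex.exponent_one] at h0 h1
  have hb := b.2
  have hb' := b'.2
  have ha : a = a' := Fin.ext (by omega)
  subst ha
  congr
  exact Fin.ext h0

lemma MonomialIndex.two_mul_card (n : ℕ) :
    2 * Fintype.card (MonomialIndex n) = (n + 1) * (n + 2) := by
  rw [Fintype.card_sigma]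
  simp only [Fintype.card_fin]
  rw [Fin.sum_univ_eq_sum_range (fun i => i + 1) (n + 1)]
  induction n with
  | zero => simp
  | succ k ih => rw [Finset.sum_range_succ, mul_add, ih]; ring

/-- There are polynomials of degree `n` along a graph with high order of vanishing at `0`. -/
lemma exists_vanishing {f : ℂ → ℂ} (hf : Differentiable ℂ f) (n : ℕ) :
    ∃ (P : MvPolynomial (Fin 2) ℂ) (M : ℕ), P ≠ 0 ∧ P.totalDegree ≤ n ∧ n ^ 2 ≤ 2 * M ∧
      ∀ k < M, iteratedDeriv k (alongGraph f P) 0 = 0 := by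
  have hcard := MonomialIndex.two_mul_card n
  set N := Fintype.card (MonomialIndex n) with hN
  set g : MonomialIndex n → ℂ → ℂ := fun i z => z ^ (i.exponent 0) * f z ^ (i.exponent 1) with hg
  have hgd : ∀ i, Differentiable ℂ (g i) := fun i => by simp only [hg]; fun_prop
  -- N unknown coefficients against the N - 1 conditions on the derivatives of orders 0, …, N - 2.
  -- The resulting order satisfies 2(N - 1) = n² + 3n.
  let φ : (MonomialIndex n → ℂ) →ₗ[ℂ] (Fin (N - 1) → ℂ) :=
    { toFun := fun c k => ∑ i, c i * iteratedDeriv k (g i) 0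
      map_add' := fun c d => by
        funext k; simp [add_mul, Finset.sum_add_distrib]
      map_smul' := fun a c => by
        funext k; simp [mul_assoc, Finset.mul_sum] }
  have hN0 : 0 < N := by nlinarith
  have hker : LinearMap.ker φ ≠ ⊥ := LinearMap.ker_ne_bot_of_finrank_lt (by
    rw [Module.finrank_fin_fun, Module.finrank_fintype_fun_eq_card]
    omega)
  obtain ⟨c, hc, hc0⟩ := Submodule.exists_mem_ne_zero_of_ne_bot hker
  set P : MvPolynomial (Fin 2) ℂ := ∑ i, MvPolynomial.monomial i.exponent (c i) with hP
  have hcoeff : ∀ i : MonomialIndex n, P.coeff i.exponent = c i := by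
    intro i
    rw [hP, MvPolynomial.coeff_sum, Finset.sum_eq_single i]
    · simp
    · intro j _ hj
      rw [MvPolynomial.coeff_monomial, if_neg]
      exact fun h => hj (MonomialIndex.exponent_injective n h)
    · simp
  have halong : alongGraph f P = fun z => ∑ i, c i * g i z := by
    funext z
    simp [alongGraph, hP, MvPolynomial.eval_monomial, Finsupp.prod_fintype, hg]
  refine ⟨P, N - 1, ?_, ?_, ?_, ?_⟩
  · intro h0
    apply hc0
    funext i
    rw [← hcoeff i, h0]
    simp
  · refine MvPolynomial.totalDegree_finsetSum_le fun i _ => ?_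
    refine (MvPolynomial.totalDegree_monomial_le _ _).trans ?_
    rw [Finsupp.sum_fintype _ _ (fun _ => rfl), Fin.sum_univ_two, i.exponent_zero, i.exponent_one]
    have h1 := i.1.2
    have h2 := i.2.2
    simp only [id]
    omega
  · have : 2 * (N - 1) = (n + 1) * (n + 2) - 2 := by omega
    rw [this, show (n + 1) * (n + 2) = n ^ 2 + 3 * n + 2 by ring]
    omega
  · intro k hk
    have h1 := congrFun (LinearMap.mem_ker.1 hc) ⟨k, hk⟩
    rw [halong, iteratedDeriv_fun_sum fun i _ =>
      (contDiff_const.mul (hgd i).contDiff).contDiffAt]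
    refine Eq.trans ?_ h1
    exact Finset.sum_congr rfl fun i _ => iteratedDeriv_const_mul (c i) (hgd i).contDiff.contDiffAt

lemma diskNorm_le_one_iff {F : ℂ → ℂ} {r : ℝ} :
    diskNorm F r ≤ 1 ↔ ∀ z ∈ closedBall (0 : ℂ) r, ‖F z‖ ≤ 1 := by
  simp only [diskNorm, iSup_le_iff]
  refine forall₂_congr fun z _ => ?_
  rw [← ofReal_norm, ENNReal.ofReal_le_one]

/-- Normalized polynomials of degree `n` that are as large as `r ^ M` with `M ≥ n² / 2` somewhere
on the circle of radius `r`. -/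
lemma exists_unitPolys_pow_le {f : ℂ → ℂ} (hf : IsEntireTranscendental f) (n : ℕ) {r : ℝ}
    (hr : 1 ≤ r) :
    ∃ P ∈ unitPolys f n, ∃ M : ℕ, n ^ 2 ≤ 2 * M ∧ ∃ z ∈ sphere (0 : ℂ) r,
      r ^ M ≤ ‖alongGraph f P z‖ := by
  obtain ⟨P, M, hP0, hdeg, hM, hvan⟩ := exists_vanishing hf.entire n
  set F := alongGraph f P with hFdef
  have hF : Differentiable ℂ F := differentiable_alongGraph hf.entire P
  obtain ⟨w, hw, hmax⟩ := (isCompact_closedBall (0 : ℂ) 1).exists_isMaxOn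
    (nonempty_closedBall.2 zero_le_one) hF.continuous.norm.continuousOn
  -- A zero maximum on the unit disk would make F vanish identically, against transcendence; hence P
  -- can be divided by F w.
  have hw0 : F w ≠ 0 := by
    intro h0
    apply hP0
    apply hf.transcendental
    have hev : F =ᶠ[𝓝 0] fun _ => 0 := by
      filter_upwards [closedBall_mem_nhds (0 : ℂ) one_pos] with y hy
      have : ‖F y‖ ≤ ‖F w‖ := hmax hy
      rwa [h0, norm_zero, norm_le_zero_iff] at this
    have := AnalyticOnNhd.eq_of_eventuallyEq (fun z _ => hF.analyticAt z)
      (fun z _ => analyticAt_const) hev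
    exact fun z => congrFun this z
  have hs : 0 < ‖F w‖ := norm_pos_iff.2 hw0
  have hal : ∀ z, alongGraph f (MvPolynomial.C (F w)⁻¹ * P) z = (F w)⁻¹ * F z := fun z => by
    simp [alongGraph, hFdef]
  obtain ⟨z, hz, hzle⟩ := exists_mem_sphere_pow_mul_norm_le hF hvan hr
  refine ⟨MvPolynomial.C (F w)⁻¹ * P, ⟨?_, ?_⟩, M, hM, z, hz, ?_⟩
  · refine (MvPolynomial.totalDegree_mul _ _).trans ?_
    simpa using hdeg
  · rw [diskNorm_le_one_iff]
    intro y hy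
    rw [hal, norm_mul, norm_inv, inv_mul_le_one₀ hs]
    exact hmax hy
  · rw [hal, norm_mul, norm_inv, le_inv_mul_iff₀ hs, mul_comm]
    exact hzle w hw

/-! ### The extremal functions with values in [0, ∞] -/

/-- The extremal function of degree `n`, divided by `n²`, with values in `[0, ∞]`. -/
noncomputable def scaledExtremal (f : ℂ → ℂ) (n : ℕ) (z : ℂ) : ℝ≥0∞ :=
  ENNReal.ofReal (((n : ℝ) ^ 2)⁻¹) *
    ⨆ P : unitPolys f n, ENNReal.ofReal (Real.log ‖alongGraph f P z‖)

/-- The upper limit of the scaled extremal functions, with values in `[0, ∞]`. -/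
noncomputable def limsupExtremal (f : ℂ → ℂ) (z : ℂ) : ℝ≥0∞ :=
  limsup (fun n => scaledExtremal f n z) atTop

/-- The extremal function `W*`, with values in `[0, ∞]`. -/
noncomputable def regExtremal (f : ℂ → ℂ) (z : ℂ) : ℝ≥0∞ :=
  limsup (limsupExtremal f) (𝓝 z)

lemma log_enorm_of_ne_zero {w : ℂ} (hw : w ≠ 0) :
    ENNReal.log ‖w‖ₑ = ((Real.log ‖w‖ : ℝ) : EReal) := by
  rw [← ofReal_norm, ENNReal.log_ofReal, if_neg (not_le.2 (norm_pos_iff.2 hw))]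

lemma one_mem_unitPolys (f : ℂ → ℂ) (n : ℕ) : (1 : MvPolynomial (Fin 2) ℂ) ∈ unitPolys f n := by
  refine ⟨by simp, ?_⟩
  rw [diskNorm_le_one_iff]
  intro z _
  simp [alongGraph]

/-- The polynomial 1 contributes 0 to the supremum, so truncating negative values, and replacing log
0 = -∞ by the default value `Real.log 0 = 0`, changes nothing. -/
lemma extremalN_eq_coe (f : ℂ → ℂ) (n : ℕ) (z : ℂ) :
    extremalN f n z =
      ((⨆ P : unitPolys f n, ENNReal.ofReal (Real.log ‖alongGraph f P z‖) : ℝ≥0∞) : EReal) := by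
  have h0 : 0 ≤ extremalN f n z := by
    refine le_trans ?_ (le_iSup₂ (f := fun P _ => ENNReal.log ‖alongGraph f P z‖ₑ) 1
      (one_mem_unitPolys f n))
    simp [alongGraph]
  apply le_antisymm
  · refine iSup₂_le fun P hP => ?_
    by_cases hz : alongGraph f P z = 0
    · simp [hz]
    · rw [log_enorm_of_ne_zero hz]
      refine le_trans ?_ (EReal.coe_ennreal_le_coe_ennreal_iff.2
        (le_iSup (fun P : unitPolys f n => ENNReal.ofReal (Real.log ‖alongGraph f P z‖)) ⟨P, hP⟩))
      rw [EReal.coe_ennreal_ofReal]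
      exact EReal.coe_le_coe_iff.2 (le_max_left _ _)
  · rw [← EReal.coe_toENNReal h0, EReal.coe_ennreal_le_coe_ennreal_iff]
    refine iSup_le fun P => ?_
    by_cases hz : alongGraph f P z = 0
    · simp [hz]
    · rw [← EReal.real_coe_toENNReal]
      apply EReal.toENNReal_le_toENNReal
      rw [← log_enorm_of_ne_zero hz]
      exact le_iSup₂_of_le P.1 P.2 le_rfl

lemma extremalN_div_eq_coe (f : ℂ → ℂ) (n : ℕ) (z : ℂ) :
    extremalN f n z / (((n : ℝ) ^ 2 : ℝ) : EReal) = (scaledExtremal f n z : EReal) := by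
  rw [scaledExtremal, EReal.coe_ennreal_mul, ← extremalN_eq_coe, EReal.coe_ennreal_ofReal,
    max_eq_left (by positivity), EReal.coe_inv, mul_comm, div_eq_mul_inv]

lemma coe_limsup {α : Type*} {l : Filter α} [l.NeBot] (u : α → ℝ≥0∞) :
    ((limsup u l : ℝ≥0∞) : EReal) = limsup (fun x => (u x : EReal)) l :=
  Monotone.map_limsup_of_continuousAt
    (fun _ _ h => EReal.coe_ennreal_le_coe_ennreal_iff.2 h) u
    continuous_coe_ennreal_ereal.continuousAt

lemma extremal_eq_coe (f : ℂ → ℂ) (z : ℂ) : extremal f z = (limsupExtremal f z : EReal) := by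
  simp only [extremal, limsupExtremal, coe_limsup, extremalN_div_eq_coe]

lemma extremalStar_eq_coe (f : ℂ → ℂ) (z : ℂ) :
    extremalStar f z = (regExtremal f z : EReal) := by
  rw [extremalStar, uscReg, regExtremal, coe_limsup]
  congr 1
  exact funext fun z => extremal_eq_coe f z

/-- The truncated logarithm is log⁺, which is continuous even at the zeros of F. -/
lemma continuous_ofReal_log_norm {F : ℂ → ℂ} (hF : Continuous F) :
    Continuous fun z => ENNReal.ofReal (Real.log ‖F z‖) := by
  have h : (fun z => ENNReal.ofReal (Real.log ‖F z‖)) =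
      fun z => ENNReal.ofReal (Real.posLog ‖F z‖) := by
    funext z
    rw [Real.posLog_apply]
    simp
  rw [h]
  exact ENNReal.continuous_ofReal.comp (Real.continuous_posLog.comp hF.norm)

/-- The supremum runs over an uncountable family, so measurability comes from lower semicontinuity.
-/
lemma measurable_scaledExtremal {f : ℂ → ℂ} (hf : Differentiable ℂ f) (n : ℕ) :
    Measurable (scaledExtremal f n) := by
  refine Measurable.const_mul (LowerSemicontinuous.measurable (lowerSemicontinuous_iSup
    fun P => Continuous.lowerSemicontinuous ?_)) _
  exact continuous_ofReal_log_norm (differentiable_alongGraph hf P).continuous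

lemma subMean_scaledExtremal {f : ℂ → ℂ} (hf : Differentiable ℂ f) (n : ℕ) :
    SubMean (scaledExtremal f n) := by
  have h : ∀ P : unitPolys f n, SubMean fun z => ENNReal.ofReal (Real.log ‖alongGraph f P z‖) :=
    fun P => subMean_log_norm (differentiable_alongGraph hf P.1)
  exact (SubMean.iSup h).const_mul ENNReal.ofReal_ne_top

lemma limsupExtremal_le {f : ℂ → ℂ} (hb : EventuallyLocallyBounded (scaledExtremal f)) (R : ℝ) :
    ∃ B : ℝ≥0∞, B ≠ ∞ ∧ ∀ z ∈ closedBall (0 : ℂ) R, limsupExtremal f z ≤ B := by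
  obtain ⟨B, hB, h⟩ := hb R
  exact ⟨B, hB, fun z hz => limsup_le_of_le (h := h.mono fun n hn => hn z hz)⟩

lemma upperSemicontinuous_regExtremal (f : ℂ → ℂ) : UpperSemicontinuous (regExtremal f) :=
  upperSemicontinuous_limsup_nhds _

lemma subMean_regExtremal {f : ℂ → ℂ} (hf : Differentiable ℂ f)
    (hb : EventuallyLocallyBounded (scaledExtremal f)) : SubMean (regExtremal f) :=
  subMean_limsup_nhds (subMean_limsup (subMean_scaledExtremal hf) (measurable_scaledExtremal hf) hb)
    (limsupExtremal_le hb)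

lemma regExtremal_ne_top {f : ℂ → ℂ} (hb : EventuallyLocallyBounded (scaledExtremal f)) (z : ℂ) :
    regExtremal f z ≠ ∞ := by
  obtain ⟨B, hB, h⟩ := limsupExtremal_le hb (‖z‖ + 1)
  refine ne_top_of_le_ne_top hB (limsup_le_of_le (h := ?_))
  filter_upwards [ball_mem_nhds z one_pos] with y hy
  refine h y ?_
  rw [mem_closedBall_zero_iff]
  rw [mem_ball, dist_eq_norm] at hy
  have := norm_sub_norm_le y z
  linarith

lemma SubMean.le_circleMean {u : ℂ → ℝ≥0∞} (hu : SubMean u) (c : ℂ) {R : ℝ} (hR : 0 < R) :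
    (u c : EReal) ≤ circleMean (fun z => (u z : EReal)) c R := by
  have h1 : ∀ x : ℝ≥0∞, (-(x : EReal)).toENNReal = 0 := fun x =>
    EReal.toENNReal_of_nonpos (by simpa using EReal.coe_ennreal_nonneg x)
  have hpi : 0 < 2 * Real.pi := by positivity
  simp only [circleMean, EReal.toENNReal_coe, h1, lintegral_zero, EReal.coe_ennreal_zero, sub_zero]
  rw [EReal.le_div_iff_mul_le (EReal.coe_pos.2 hpi) (EReal.coe_ne_top _)]
  have h2 : ((2 * Real.pi : ℝ) : EReal) = (ENNReal.ofReal (2 * Real.pi) : EReal) := by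
    rw [EReal.coe_ennreal_ofReal, max_eq_left hpi.le]
  rw [h2, ← EReal.coe_ennreal_mul, EReal.coe_ennreal_le_coe_ennreal_iff, mul_comm]
  exact hu c R hR.ne'

lemma isSubharmonic_extremalStar {f : ℂ → ℂ} (hf : Differentiable ℂ f)
    (hb : EventuallyLocallyBounded (scaledExtremal f)) : IsSubharmonic (extremalStar f) := by
  refine ⟨upperSemicontinuous_limsup_nhds _, fun z => ?_, fun c R hR => ?_⟩
  · rw [extremalStar_eq_coe, ne_eq, EReal.coe_ennreal_eq_top_iff]
    exact regExtremal_ne_top hb z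
  · rw [extremalStar_eq_coe, funext (extremalStar_eq_coe f)]
    exact (subMean_regExtremal hf hb).le_circleMean c hR

/-! ### Bounds for W* on circles -/

lemma regExtremal_le_posLog {f : ℂ → ℂ} {C : ℝ}
    (h : ∀ z, limsupExtremal f z ≤ ENNReal.ofReal (C * Real.posLog ‖z‖)) (z : ℂ) :
    regExtremal f z ≤ ENNReal.ofReal (C * Real.posLog ‖z‖) := by
  have hc : Continuous fun z : ℂ => ENNReal.ofReal (C * Real.posLog ‖z‖) :=
    ENNReal.continuous_ofReal.comp
      (continuous_const.mul (Real.continuous_posLog.comp continuous_norm))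
  rw [← (hc.tendsto z).limsup_eq]
  exact limsup_le_limsup (Eventually.of_forall h)

/-- The lower bound for the maximum of the extremal function on circles. -/
lemma exists_mem_sphere_le_regExtremal {f : ℂ → ℂ} (hf : IsEntireTranscendental f)
    (hb : EventuallyLocallyBounded (scaledExtremal f)) {r : ℝ} (hr : 1 ≤ r) :
    ∃ z ∈ sphere (0 : ℂ) r, ENNReal.ofReal (1 / 2 * Real.log r) ≤ regExtremal f z ∧
      ∀ w ∈ sphere (0 : ℂ) r, regExtremal f w ≤ regExtremal f z := by
  obtain ⟨z, hz, hmax⟩ := ((upperSemicontinuous_regExtremal f).upperSemicontinuousOn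
    (sphere (0 : ℂ) r)).exists_isMaxOn (NormedSpace.sphere_nonempty.2 (by linarith))
    (isCompact_sphere 0 r)
  refine ⟨z, hz, ?_, fun w hw => hmax hw⟩
  -- For A above the maximum of W* on the circle, Hartogs' lemma bounds the n-th function by A on
  -- the whole circle for large n, in particular at the n-dependent point where the constructed
  -- polynomial is large.
  refine le_of_forall_gt_imp_ge_of_dense fun A hA => ?_
  have hev := eventually_forall_le_of_isCompact (subMean_scaledExtremal hf.entire)
    (measurable_scaledExtremal hf.entire) hb (isCompact_sphere (0 : ℂ) r)
    (A := A) (fun w hw => (show regExtremal f w ≤ regExtremal f z from hmax hw).trans_lt hA)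
  obtain ⟨n, hn, hn1⟩ := (hev.and (eventually_ge_atTop 1)).exists
  obtain ⟨P, hP, M, hM, y, hy, hle⟩ := exists_unitPolys_pow_le hf n hr
  refine le_trans ?_ (hn y hy)
  refine le_trans ?_ (mul_le_mul_right (le_iSup (fun P : unitPolys f n =>
    ENNReal.ofReal (Real.log ‖alongGraph f P y‖)) ⟨P, hP⟩) _)
  rw [← ENNReal.ofReal_mul (by positivity)]
  apply ENNReal.ofReal_le_ofReal
  have hn0 : (0 : ℝ) < (n : ℝ) ^ 2 := by positivity
  rw [le_inv_mul_iff₀ hn0]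
  have h1 : M * Real.log r ≤ Real.log ‖alongGraph f P y‖ := by
    rw [← Real.log_pow]
    exact Real.log_le_log (by positivity) hle
  have h2 : (n : ℝ) ^ 2 ≤ 2 * M := by exact_mod_cast hM
  have h3 := Real.log_nonneg hr
  nlinarith

/-- Part of the proposition that does not depend on how the growth of polynomials is controlled. -/
lemma extremalStar_properties {f : ℂ → ℂ} (hf : IsEntireTranscendental f)
    (hb : EventuallyLocallyBounded (scaledExtremal f)) {C : ℝ}
    (hC : ∀ z, limsupExtremal f z ≤ ENNReal.ofReal (C * Real.posLog ‖z‖)) :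
    IsSubharmonic (extremalStar f) ∧ (∀ z : ℂ, 0 ≤ extremalStar f z) ∧
      (∀ z ∈ closedBall (0 : ℂ) 1, extremalStar f z = 0) ∧
      (∀ r : ℝ, 1 ≤ r → ∃ M : ℝ,
        IsGreatest (extremalStar f '' sphere (0 : ℂ) r) (M : EReal) ∧
        (1 / 2) * Real.log r ≤ M ∧ M ≤ C * Real.log r) := by
  refine ⟨isSubharmonic_extremalStar hf.entire hb, fun z => ?_, fun z hz => ?_, fun r hr => ?_⟩
  · rw [extremalStar_eq_coe]
    exact EReal.coe_ennreal_nonneg _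
  · rw [extremalStar_eq_coe, EReal.coe_ennreal_eq_zero]
    have h := regExtremal_le_posLog hC z
    rw [mem_closedBall_zero_iff] at hz
    rwa [(Real.posLog_eq_zero_iff ‖z‖).2 (by rwa [abs_norm]), mul_zero, ENNReal.ofReal_zero,
      nonpos_iff_eq_zero] at h
  · obtain ⟨z, hz, hlow, hmax⟩ := exists_mem_sphere_le_regExtremal hf hb hr
    have hzn : ‖z‖ = r := by simpa using hz
    have htop := regExtremal_ne_top hb z
    have hup := regExtremal_le_posLog hC z
    rw [hzn, Real.posLog_eq_log (by rwa [abs_of_nonneg (by linarith)])] at hup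
    have hlog := Real.log_nonneg hr
    refine ⟨(regExtremal f z).toReal, ⟨⟨z, hz, ?_⟩, ?_⟩, ?_, ?_⟩
    · rw [extremalStar_eq_coe, EReal.coe_ennreal_toReal htop]
    · rintro _ ⟨w, hw, rfl⟩
      rw [extremalStar_eq_coe, EReal.coe_ennreal_toReal htop,
        EReal.coe_ennreal_le_coe_ennreal_iff]
      exact hmax w hw
    · exact (ENNReal.ofReal_le_iff_le_toReal htop).1 hlow
    -- C is not assumed non-negative; if C log r ≤ 0, the two bounds together force log r = 0.
    · rcases le_total 0 (C * Real.log r) with h | h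
      · exact ENNReal.toReal_le_of_le_ofReal h hup
      · have h0 := hlow.trans hup
        rw [ENNReal.ofReal_of_nonpos h, nonpos_iff_eq_zero, ENNReal.ofReal_eq_zero] at h0
        have hl0 : Real.log r = 0 := by linarith
        rw [hl0, mul_zero] at hup ⊢
        simpa using (ENNReal.toReal_mono ENNReal.ofReal_ne_top hup)

lemma scaledExtremal_le {f : ℂ → ℂ} {n : ℕ} {z : ℂ} {A : ℝ}
    (h : extremalN f n z ≤ ((A * (n : ℝ) ^ 2 : ℝ) : EReal)) (hn : 1 ≤ n) :
    scaledExtremal f n z ≤ ENNReal.ofReal A := by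
  rw [extremalN_eq_coe] at h
  have h1 := EReal.toENNReal_le_toENNReal h
  rw [EReal.toENNReal_coe, EReal.real_coe_toENNReal] at h1
  refine (mul_le_mul_right h1 _).trans ?_
  rw [← ENNReal.ofReal_mul (by positivity)]
  apply ENNReal.ofReal_le_ofReal
  have hn0 : (0 : ℝ) < (n : ℝ) ^ 2 := by positivity
  rw [inv_mul_le_iff₀ hn0]
  linarith

lemma extremalN_le_growth (f : ℂ → ℂ) (n : ℕ) {z : ℂ} {r : ℝ} (hz : ‖z‖ ≤ r) :
    extremalN f n z ≤ growth f n r := by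
  refine iSup₂_mono fun P _ => ENNReal.log_monotone ?_
  exact le_iSup₂ (f := fun w (_ : w ∈ closedBall (0 : ℂ) r) => ‖alongGraph f P w‖ₑ) z
    (mem_closedBall_zero_iff.2 hz)

lemma scaledExtremal_le_of_growth {f : ℂ → ℂ} {C : ℝ} {ρ : ℕ → ℝ}
    (h : ∀ n : ℕ, 1 ≤ n → ∀ r : ℝ, 1 ≤ r → r ≤ ρ n →
      growth f n r ≤ ((C * (n : ℝ) ^ 2 * Real.log r : ℝ) : EReal))
    {n : ℕ} (hn : 1 ≤ n) {z : ℂ} (hz : max 1 ‖z‖ ≤ ρ n) :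
    scaledExtremal f n z ≤ ENNReal.ofReal (C * Real.posLog ‖z‖) := by
  refine scaledExtremal_le ?_ hn
  -- The growth bound is available only for radii at least 1, and log max(1, |z|) = log⁺|z|.
  refine (extremalN_le_growth f n (le_max_right 1 ‖z‖)).trans
    ((h n hn _ (le_max_left _ _) hz).trans (le_of_eq ?_))
  rw [Real.posLog_eq_log_max_one (norm_nonneg z)]
  congr 1
  ring

/-! ### The exponential: transcendence and annihilating operators -/

/-- By periodicity, for w ≠ 0 the polynomial P(·, w) vanishes at all the points log w + 2πik, hence
identically. So w P(z, w) is zero everywhere, and w can be cancelled. -/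
lemma isEntireTranscendental_exp : IsEntireTranscendental Complex.exp := by
  refine ⟨Complex.differentiable_exp, fun P hP => ?_⟩
  have hzero : ∀ (c : ℂ) (w : ℂ), w ≠ 0 → MvPolynomial.eval ![c, w] P = 0 := by
    intro c w hw
    set q : Polynomial ℂ := MvPolynomial.aeval ![Polynomial.X, Polynomial.C w] P with hq
    have hqe : ∀ x, q.eval x = MvPolynomial.eval ![x, w] P := by
      intro x
      have hcomp : (Polynomial.aeval x).comp (MvPolynomial.aeval ![Polynomial.X, Polynomial.C w]) =
          MvPolynomial.aeval (R := ℂ) ![x, w] := by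
        refine MvPolynomial.algHom_ext fun i => ?_
        fin_cases i <;> simp
      have h := DFunLike.congr_fun hcomp P
      rw [AlgHom.comp_apply, Polynomial.coe_aeval_eq_eval] at h
      rw [← MvPolynomial.coe_aeval_eq_eval]
      exact h
    have hq0 : q = 0 := by
      refine Polynomial.eq_zero_of_infinite_isRoot q ?_
      refine Set.Infinite.mono ?_ (Set.infinite_range_of_injective
        (f := fun k : ℕ => Complex.log w + k * (2 * Real.pi * Complex.I)) ?_)
      · rintro _ ⟨k, rfl⟩
        have := hP (Complex.log w + k * (2 * Real.pi * Complex.I))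
        rw [alongGraph, Complex.exp_add, Complex.exp_log hw, Complex.exp_nat_mul_two_pi_mul_I,
          mul_one] at this
        change q.eval _ = 0
        rw [hqe, this]
      · intro k l hkl
        have h2 : (2 * Real.pi * Complex.I : ℂ) ≠ 0 := Complex.two_pi_I_ne_zero
        simpa [h2] using hkl
    rw [← hqe, hq0, Polynomial.eval_zero]
  have hmul : P * MvPolynomial.X 1 = 0 := by
    apply MvPolynomial.funext
    intro x
    have hx : x = ![x 0, x 1] := by
      funext i; fin_cases i <;> rfl
    by_cases h1 : x 1 = 0
    · simp [h1]
    · rw [hx, map_mul, hzero _ _ h1]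
      simp
  exact (mul_eq_zero.1 hmul).resolve_right (MvPolynomial.X_ne_zero 1)

/-- The derivation of `ℂ[z, w]` that corresponds to `d/dz` along the graph of `exp`. -/
noncomputable def expDerivation :
    Derivation ℂ (MvPolynomial (Fin 2) ℂ) (MvPolynomial (Fin 2) ℂ) :=
  MvPolynomial.mkDerivation ℂ ![1, MvPolynomial.X 1]

lemma hasDerivAt_alongGraph_exp (P : MvPolynomial (Fin 2) ℂ) (z : ℂ) :
    HasDerivAt (alongGraph Complex.exp P) (alongGraph Complex.exp (expDerivation P) z) z := by
  induction P using MvPolynomial.induction_on with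
  | C a =>
    have : alongGraph Complex.exp (MvPolynomial.C a) = fun _ => a := by
      funext z; simp [alongGraph]
    rw [this]
    simpa [alongGraph, expDerivation] using hasDerivAt_const z a
  | add p q hp hq =>
    have : alongGraph Complex.exp (p + q) = alongGraph Complex.exp p + alongGraph Complex.exp q := by
      funext z; simp [alongGraph]
    rw [this]
    simpa [alongGraph] using! hp.add hq
  | mul_X p i hp =>
    have hX : HasDerivAt (alongGraph Complex.exp (MvPolynomial.X i))
        (alongGraph Complex.exp (expDerivation (MvPolynomial.X i)) z) z := by
      fin_cases i
      · have : alongGraph Complex.exp (MvPolynomial.X 0) = id := by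
          funext z; simp [alongGraph]
        simpa [this, alongGraph, expDerivation] using hasDerivAt_id z
      · have : alongGraph Complex.exp (MvPolynomial.X 1) = Complex.exp := by
          funext z; simp [alongGraph]
        simpa [this, alongGraph, expDerivation] using Complex.hasDerivAt_exp z
    have : alongGraph Complex.exp (p * MvPolynomial.X i) =
        alongGraph Complex.exp p * alongGraph Complex.exp (MvPolynomial.X i) := by
      funext z; simp [alongGraph]
    rw [this]
    refine (hp.mul hX).congr_deriv ?_
    simp only [alongGraph, Derivation.leibniz, map_add, map_mul, smul_eq_mul]
    ring

/-- The composition of the operators `D - k`, where `D` is the derivation along the graph of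
`exp` and `k` runs through a list. -/
noncomputable def shiftedDerivs :
    List ℕ → (MvPolynomial (Fin 2) ℂ →ₗ[ℂ] MvPolynomial (Fin 2) ℂ)
  | [] => LinearMap.id
  | k :: L => shiftedDerivs L ∘ₗ ((expDerivation : _ →ₗ[ℂ] _) - (k : ℂ) • LinearMap.id)

lemma shiftedDerivs_cons (k : ℕ) (L : List ℕ) (P : MvPolynomial (Fin 2) ℂ) :
    shiftedDerivs (k :: L) P = shiftedDerivs L (expDerivation P - (k : ℂ) • P) := rfl

open MvPolynomial in
-- D - k sends z^a w^b to a z^{a-1} w^b + (b - k) z^a w^b: the power of z never rises, and each k =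
-- b lowers it by one or kills the monomial when a = 0.
lemma shiftedDerivs_monomial_eq_zero (L : List ℕ) (a b : ℕ) (h : a < L.count b) :
    shiftedDerivs L (X 0 ^ a * X 1 ^ b) = 0 := by
  induction L generalizing a with
  | nil => simp at h
  | cons k L ih =>
    have hD : expDerivation (X 0 ^ a * X 1 ^ b : MvPolynomial (Fin 2) ℂ) =
        (a : ℂ) • (X 0 ^ (a - 1) * X 1 ^ b) + (b : ℂ) • (X 0 ^ a * X 1 ^ b) := by
      have hb : (b : MvPolynomial (Fin 2) ℂ) * X 1 ^ (b - 1) * X 1 =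
          (b : MvPolynomial (Fin 2) ℂ) * X 1 ^ b := by
        cases b with
        | zero => simp
        | succ b => rw [Nat.add_sub_cancel, pow_succ]; ring
      simp only [expDerivation, Derivation.leibniz, Derivation.leibniz_pow, mkDerivation_X,
        Matrix.cons_val_zero, Matrix.cons_val_one, smul_eq_mul, nsmul_eq_mul, mul_one,
        MvPolynomial.smul_eq_C_mul, map_natCast]
      linear_combination X 0 ^ a * hb
    rw [shiftedDerivs_cons, hD, add_sub_assoc, ← sub_smul, map_add, map_smul, map_smul]
    have hfirst : (a : ℂ) • shiftedDerivs L (X 0 ^ (a - 1) * X 1 ^ b) = 0 := by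
      rcases Nat.eq_zero_or_pos a with rfl | ha
      · simp
      · rw [ih (a - 1), smul_zero]
        rw [List.count_cons] at h
        split_ifs at h <;> omega
    rw [hfirst, zero_add]
    by_cases hk : k = b
    · simp [hk]
    · rw [ih a, smul_zero]
      rwa [List.count_cons_of_ne hk] at h

/-- The list in which `b < n` occurs `n - b` times. -/
def frequencyList : ℕ → List ℕ
  | 0 => []
  | n + 1 => frequencyList n ++ List.range (n + 1)

lemma count_frequencyList (n b : ℕ) : (frequencyList n).count b = n - b := by
  induction n with
  | zero => simp [frequencyList]
  | succ n ih =>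
    rw [frequencyList, List.count_append, ih]
    by_cases hb : b ≤ n
    · rw [List.count_eq_one_of_mem List.nodup_range (List.mem_range.2 (by omega))]
      omega
    · rw [List.count_eq_zero_of_not_mem (by rw [List.mem_range]; omega)]
      omega

lemma two_mul_length_frequencyList (n : ℕ) : 2 * (frequencyList n).length = n * (n + 1) := by
  induction n with
  | zero => simp [frequencyList]
  | succ n ih =>
    rw [frequencyList, List.length_append, List.length_range, mul_add, ih]
    ring

lemma le_of_mem_frequencyList {n k : ℕ} (h : k ∈ frequencyList (n + 1)) : k ≤ n := by
  have := List.count_pos_iff.2 h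
  rw [count_frequencyList] at this
  omega

/-- The frequency b occurs n + 1 - b times, which exceeds a whenever a + b ≤ n. -/
lemma shiftedDerivs_frequencyList_eq_zero {n : ℕ} {P : MvPolynomial (Fin 2) ℂ}
    (hP : P.totalDegree ≤ n) : shiftedDerivs (frequencyList (n + 1)) P = 0 := by
  rw [P.as_sum, map_sum]
  refine Finset.sum_eq_zero fun d hd => ?_
  have hdeg : d 0 + d 1 ≤ n := by
    have := (MvPolynomial.le_totalDegree hd).trans hP
    rwa [Finsupp.sum_fintype _ _ (fun _ => rfl), Fin.sum_univ_two] at this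
  rw [MvPolynomial.monomial_eq, Finsupp.prod_fintype _ _ (fun _ => pow_zero _), Fin.prod_univ_two,
    ← MvPolynomial.smul_eq_C_mul, map_smul, shiftedDerivs_monomial_eq_zero, smul_zero]
  rw [count_frequencyList]
  omega

/-! ### The Bernstein-Walsh inequality for exp -/

/-- Variation of constants, one factor D - k at a time: with Q = (D - k)P, the function e^{k(1-t)z}
F(tz) has derivative z e^{k(1-t)z} Q(tz, e^{tz}). Integrating the inductive bound for Q over [0, 1]
raises each power by one and adds the initial value |F 0|. -/
lemma norm_alongGraph_exp_le (K : ℝ) (L : List ℕ) (hL : ∀ k ∈ L, (k : ℝ) ≤ K)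
    (P : MvPolynomial (Fin 2) ℂ) (hP : shiftedDerivs L P = 0) (z : ℂ) :
    ‖alongGraph Complex.exp P z‖ ≤ Real.exp (K * ‖z‖) * ∑ m ∈ Finset.range L.length,
      ‖alongGraph Complex.exp (shiftedDerivs (L.take m) P) 0‖ * (‖z‖ ^ m / m.factorial) := by
  induction L generalizing P z with
  | nil =>
    have : P = 0 := hP
    simp [this, alongGraph]
  | cons k L ih =>
    set Q := expDerivation P - (k : ℂ) • P with hQ
    rw [shiftedDerivs_cons] at hP
    have hkK : (k : ℝ) ≤ K := hL k (by simp)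
    have hIH := ih (fun k hk => hL k (List.mem_cons_of_mem _ hk)) Q hP
    set q : ℕ → ℝ := fun m => ‖alongGraph Complex.exp (shiftedDerivs (L.take m) Q) 0‖ with hq
    set F := alongGraph Complex.exp P with hF
    have hQF : ∀ w, alongGraph Complex.exp Q w =
        alongGraph Complex.exp (expDerivation P) w - k * F w := fun w => by
      simp [alongGraph, hQ, hF]
    set h : ℝ → ℂ := fun t => Complex.exp (k * ((1 - t) * z)) * F (t * z) with hh
    have hderiv : ∀ t : ℝ, HasDerivAt h
        (z * Complex.exp (k * ((1 - t) * z)) * alongGraph Complex.exp Q (t * z)) t := by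
      intro t
      have h1 : HasDerivAt (fun s : ℂ => Complex.exp (k * ((1 - s) * z)))
          (Complex.exp (k * ((1 - t) * z)) * (k * ((0 - 1) * z))) (t : ℂ) :=
        ((((hasDerivAt_const (t : ℂ) (1 : ℂ)).sub (hasDerivAt_id (t : ℂ))).mul_const z).const_mul
          (k : ℂ)).cexp
      have h2 : HasDerivAt (fun s : ℂ => F (s * z))
          (alongGraph Complex.exp (expDerivation P) (t * z) * (1 * z)) (t : ℂ) :=
        HasDerivAt.comp (h := fun s : ℂ => s * z) (h₂ := F) (t : ℂ)
          (hasDerivAt_alongGraph_exp P (t * z)) ((hasDerivAt_id (t : ℂ)).mul_const z)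
      refine (h1.mul h2).comp_ofReal.congr_deriv ?_
      rw [hQF]
      ring
    -- The integrated bound as an explicit majorant, so that comparing derivatives replaces
    -- integration. The exponentials for the parts t and 1 - t of the segment combine to e^{K|z|}.
    set B : ℝ → ℝ := fun t => Real.exp (K * ‖z‖) * (‖F 0‖ + ∑ m ∈ Finset.range L.length,
      q m * ‖z‖ ^ (m + 1) / (m + 1).factorial * t ^ (m + 1)) with hB
    set B' : ℝ → ℝ := fun t => Real.exp (K * ‖z‖) * (0 + ∑ m ∈ Finset.range L.length,
      q m * ‖z‖ ^ (m + 1) / (m + 1).factorial * (((m + 1 : ℕ) : ℝ) * t ^ m)) with hB'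
    have hBd : ∀ t, HasDerivAt B (B' t) t := by
      intro t
      refine HasDerivAt.const_mul _ ((hasDerivAt_const t _).add (HasDerivAt.fun_sum fun m _ => ?_))
      exact (hasDerivAt_pow (m + 1) t).const_mul _
    have hexp : ∀ s : ℝ, 0 ≤ s → ‖Complex.exp (k * (s * z))‖ ≤ Real.exp (K * (s * ‖z‖)) := by
      intro s hs
      refine (Complex.norm_exp_le_exp_norm _).trans (Real.exp_le_exp.2 ?_)
      rw [norm_mul, norm_mul, Complex.norm_natCast, Complex.norm_of_nonneg hs]
      gcongr
    have hmain := image_norm_le_of_norm_deriv_right_le_deriv_boundary (f := h) (a := 0) (b := 1)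
      (fun t _ => (hderiv t).continuousAt.continuousWithinAt)
      (fun t _ => (hderiv t).hasDerivWithinAt) (B := B) (B' := B') (by
        have := hexp 1 zero_le_one
        simp only [hh, hB, norm_mul]
        simp only [Complex.ofReal_zero, sub_zero, zero_mul, Complex.ofReal_one, one_mul] at this ⊢
        simp only [ne_eq, Nat.add_eq_zero_iff, one_ne_zero, and_false, not_false_eq_true, zero_pow,
          mul_zero, Finset.sum_const_zero, add_zero]
        gcongr) hBd (by
        intro t ht
        have h1 := hexp (1 - t) (by linarith [ht.2])
        have h2 := hIH (t * z)
        have hn : ‖(t : ℂ) * z‖ = t * ‖z‖ := by rw [norm_mul, Complex.norm_of_nonneg ht.1]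
        rw [hn] at h2
        push_cast at h1
        rw [norm_mul, norm_mul]
        calc ‖z‖ * ‖Complex.exp (k * ((1 - t) * z))‖ * ‖alongGraph Complex.exp Q (t * z)‖
            ≤ ‖z‖ * Real.exp (K * ((1 - t) * ‖z‖)) * (Real.exp (K * (t * ‖z‖)) *
              ∑ m ∈ Finset.range L.length, q m * ((t * ‖z‖) ^ m / m.factorial)) := by gcongr
          _ = Real.exp (K * ((1 - t) * ‖z‖)) * Real.exp (K * (t * ‖z‖)) *
              (‖z‖ * ∑ m ∈ Finset.range L.length, q m * ((t * ‖z‖) ^ m / m.factorial)) := by ring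
          _ = B' t := by
              rw [← Real.exp_add, Finset.mul_sum]
              simp only [hB', zero_add]
              congr 1
              · congr 1; ring
              · refine Finset.sum_congr rfl fun m _ => ?_
                rw [Nat.factorial_succ, Nat.cast_mul, mul_pow, pow_succ]
                have := Nat.factorial_ne_zero m
                field_simp)
    have hfin := hmain (Set.right_mem_Icc.2 zero_le_one)
    have hh1 : h 1 = F z := by simp [hh]
    rw [hh1] at hfin
    refine hfin.trans (le_of_eq ?_)
    simp only [hB, List.length_cons]
    rw [Finset.sum_range_succ', add_comm]
    congr 2
    · refine Finset.sum_congr rfl fun m _ => ?_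
      rw [List.take_succ_cons, shiftedDerivs_cons]
      simp only [hq, one_pow, mul_one]
      ring
    · simp [shiftedDerivs, hF]

/-- The linear functional on polynomials that maps `X ^ j` to `j!`. -/
noncomputable def factorialFunctional : Polynomial ℝ →ₗ[ℝ] ℝ :=
  Polynomial.lsum fun j => (j.factorial : ℝ) • LinearMap.id

lemma factorialFunctional_X_pow (j : ℕ) :
    factorialFunctional (Polynomial.X ^ j) = j.factorial := by
  rw [factorialFunctional, Polynomial.lsum_apply, ← Polynomial.monomial_one_right_eq_X_pow,
    Polynomial.sum_monomial_index] <;> simp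

/-- The binomial expansion gives m! times a partial sum of the exponential series at K. -/
lemma factorialFunctional_pow_le {K : ℝ} (hK : 0 ≤ K) (m : ℕ) :
    factorialFunctional ((Polynomial.X + Polynomial.C K) ^ m) ≤ Real.exp K * m.factorial := by
  rw [add_pow, map_sum]
  have h : ∀ i ∈ Finset.range (m + 1), factorialFunctional (Polynomial.X ^ i *
      Polynomial.C K ^ (m - i) * (m.choose i : Polynomial ℝ)) =
      m.factorial * (K ^ (m + 1 - 1 - i) / (m + 1 - 1 - i).factorial) := by
    intro i hi
    have hi' : i ≤ m := Nat.lt_succ_iff.1 (Finset.mem_range.1 hi)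
    have h1 : (Polynomial.X ^ i * Polynomial.C K ^ (m - i) * (m.choose i : Polynomial ℝ)) =
        (K ^ (m - i) * m.choose i) • (Polynomial.X ^ i : Polynomial ℝ) := by
      rw [Polynomial.smul_eq_C_mul]
      simp only [map_mul, map_pow, map_natCast]
      ring
    rw [h1, map_smul, factorialFunctional_X_pow, smul_eq_mul, Nat.add_sub_cancel,
      ← Nat.choose_mul_factorial_mul_factorial hi']
    push_cast
    have := Nat.factorial_ne_zero (m - i)
    field_simp
  rw [Finset.sum_congr rfl h, ← Finset.mul_sum,
    Finset.sum_range_reflect (fun i => K ^ i / (i.factorial : ℝ)) (m + 1), mul_comm]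
  gcongr
  exact Real.sum_le_exp_of_nonneg hK _

lemma iteratedDeriv_alongGraph_exp (j : ℕ) (P : MvPolynomial (Fin 2) ℂ) :
    iteratedDeriv j (alongGraph Complex.exp P) =
      alongGraph Complex.exp (expDerivation^[j] P) := by
  induction j generalizing P with
  | zero => simp
  | succ j ih =>
    have : deriv (alongGraph Complex.exp P) = alongGraph Complex.exp (expDerivation P) :=
      funext fun z => (hasDerivAt_alongGraph_exp P z).deriv
    rw [iteratedDeriv_succ', this, ih, Function.iterate_succ_apply]

lemma iterate_expDerivation_sub (j : ℕ) (P Q : MvPolynomial (Fin 2) ℂ) (c : ℂ) :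
    expDerivation^[j] (P - c • Q) = expDerivation^[j] P - c • expDerivation^[j] Q := by
  induction j generalizing P Q with
  | zero => rfl
  | succ j ih => rw [Function.iterate_succ_apply, map_sub, Derivation.map_smul, ih]; rfl

/-- Symbolic bookkeeping: X^j stands for the Cauchy bound j! on the j-th derivative at 0, so D acts
as multiplication by X, and D - k with k ≤ K is dominated by multiplication by X + K. The general p
makes the induction run. -/
lemma norm_iterate_shiftedDerivs_le (K : ℝ) (L : List ℕ) (hL : ∀ k ∈ L, (k : ℝ) ≤ K)
    (P : MvPolynomial (Fin 2) ℂ) (p : Polynomial ℝ)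
    (hP : ∀ j, ‖alongGraph Complex.exp (expDerivation^[j] P) 0‖ ≤
      factorialFunctional (Polynomial.X ^ j * p)) (j : ℕ) :
    ‖alongGraph Complex.exp (expDerivation^[j] (shiftedDerivs L P)) 0‖ ≤
      factorialFunctional (Polynomial.X ^ j * ((Polynomial.X + Polynomial.C K) ^ L.length * p)) := by
  induction L generalizing P p with
  | nil => simpa [shiftedDerivs] using hP j
  | cons k L ih =>
    rw [shiftedDerivs_cons, List.length_cons, pow_succ, mul_assoc]
    refine ih (fun k hk => hL k (List.mem_cons_of_mem _ hk)) _ _ fun j => ?_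
    have h1 : (Polynomial.X ^ j * ((Polynomial.X + Polynomial.C K) * p)) =
        Polynomial.X ^ (j + 1) * p + K • (Polynomial.X ^ j * p) := by
      rw [Polynomial.smul_eq_C_mul]; ring
    have h2 : alongGraph Complex.exp (expDerivation^[j] (expDerivation P - (k : ℂ) • P)) 0 =
        alongGraph Complex.exp (expDerivation^[j + 1] P) 0 -
          k * alongGraph Complex.exp (expDerivation^[j] P) 0 := by
      rw [iterate_expDerivation_sub, Function.iterate_succ_apply]
      simp [alongGraph]
    rw [h1, h2, map_add, map_smul, smul_eq_mul]
    refine (norm_sub_le _ _).trans (add_le_add (hP (j + 1)) ?_)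
    rw [norm_mul, Complex.norm_natCast]
    exact mul_le_mul (hL k (by simp)) (hP j) (norm_nonneg _)
      ((Nat.cast_nonneg k).trans (hL k (by simp)))

/-- The Bernstein-Walsh inequality along the graph of `exp`. -/
lemma norm_alongGraph_exp_le_of_unitPolys {n : ℕ} {P : MvPolynomial (Fin 2) ℂ}
    (hP : P ∈ unitPolys Complex.exp n) {N : ℕ} (hN : 2 * N = (n + 1) * (n + 2)) {r : ℝ}
    (hr : 1 ≤ r) {z : ℂ} (hz : ‖z‖ ≤ r) :
    ‖alongGraph Complex.exp P z‖ ≤ Real.exp (n * (r + 1)) * (N * r ^ N) := by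
  obtain ⟨hdeg, hnorm⟩ := hP
  rw [diskNorm_le_one_iff] at hnorm
  have hlen : (frequencyList (n + 1)).length = N := by
    have := two_mul_length_frequencyList (n + 1)
    rw [← hN] at this
    omega
  have hL : ∀ k ∈ frequencyList (n + 1), (k : ℝ) ≤ n := fun k hk =>
    by exact_mod_cast le_of_mem_frequencyList hk
  have hCauchy : ∀ j, ‖alongGraph Complex.exp (expDerivation^[j] P) 0‖ ≤
      factorialFunctional (Polynomial.X ^ j * 1) := by
    intro j
    rw [mul_one, factorialFunctional_X_pow, ← iteratedDeriv_alongGraph_exp]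
    have := Complex.norm_iteratedDeriv_le_of_forall_mem_sphere_norm_le (c := 0) (C := 1) j one_pos
      (differentiable_alongGraph Complex.differentiable_exp P).diffContOnCl
      (fun w hw => hnorm w (sphere_subset_closedBall hw))
    simpa using this
  have hcoef : ∀ m ∈ Finset.range N,
      ‖alongGraph Complex.exp (shiftedDerivs ((frequencyList (n + 1)).take m) P) 0‖ ≤
        Real.exp n * m.factorial := by
    intro m hm
    have h1 := norm_iterate_shiftedDerivs_le n ((frequencyList (n + 1)).take m)
      (fun k hk => hL k (List.mem_of_mem_take hk)) P 1 hCauchy 0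
    have h2 : ((frequencyList (n + 1)).take m).length = m := by
      rw [List.length_take, hlen, min_eq_left (Finset.mem_range.1 hm).le]
    rw [h2, pow_zero, one_mul, mul_one] at h1
    exact h1.trans (factorialFunctional_pow_le (Nat.cast_nonneg n) m)
  have hmain := norm_alongGraph_exp_le n _ hL P (shiftedDerivs_frequencyList_eq_zero hdeg) z
  rw [hlen] at hmain
  refine hmain.trans ?_
  -- The m! in the coefficient bound cancels the m! of the Taylor term.
  have hsum : ∑ m ∈ Finset.range N,
      ‖alongGraph Complex.exp (shiftedDerivs ((frequencyList (n + 1)).take m) P) 0‖ *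
        (‖z‖ ^ m / m.factorial) ≤ ∑ m ∈ Finset.range N, Real.exp n * r ^ N := by
    refine Finset.sum_le_sum fun m hm => ?_
    have hm' := (Finset.mem_range.1 hm).le
    calc _ ≤ Real.exp n * m.factorial * (r ^ N / m.factorial) := by
          gcongr
          · exact hcoef m hm
          · exact (pow_le_pow_left₀ (norm_nonneg _) hz m).trans (pow_le_pow_right₀ hr hm')
      _ = Real.exp n * r ^ N := by
          have := Nat.factorial_ne_zero m
          field_simp
  rw [Finset.sum_const, Finset.card_range, nsmul_eq_mul] at hsum
  calc _ ≤ Real.exp (n * r) * (N * (Real.exp n * r ^ N)) := by gcongr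
    _ = _ := by rw [mul_add, mul_one, Real.exp_add]; ring

/-! ### The extremal function of exp -/

/-- The majorant of the scaled extremal function of `exp` given by the Bernstein-Walsh inequality,
as a function of `t = 1 / n` and `r = max 1 ‖z‖`. -/
noncomputable def expMajorant (r t : ℝ) : ℝ :=
  1 / 2 * Real.log r * (1 + 3 * t + 2 * t ^ 2) + (r + 3) * t + 2 * t ^ 2

lemma scaledExtremal_exp_le {n : ℕ} (hn : 1 ≤ n) {r : ℝ} (hr : 1 ≤ r) {z : ℂ} (hz : ‖z‖ ≤ r) :
    scaledExtremal Complex.exp n z ≤ ENNReal.ofReal (expMajorant r (n : ℝ)⁻¹) := by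
  have hn0 : (0 : ℝ) < n := by exact_mod_cast hn
  have hL := Real.log_nonneg hr
  set N := Fintype.card (MonomialIndex n) with hN
  have hN2 : 2 * N = (n + 1) * (n + 2) := MonomialIndex.two_mul_card n
  have hN2' : 2 * (N : ℝ) = (n + 1) * (n + 2) := by exact_mod_cast hN2
  have hN0 : (0 : ℝ) < N := by nlinarith
  -- Crude but sufficient: N ≤ (n + 2)² and log x ≤ x - 1, and any bound of order o(n²) would
  -- disappear in the limit.
  have hlogN : Real.log N ≤ 2 * (n + 1) := by
    have h1 : (N : ℝ) ≤ (n + 2) ^ 2 := by nlinarith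
    have h2 := Real.log_le_log hN0 h1
    rw [Real.log_pow] at h2
    have h3 := Real.log_le_sub_one_of_pos (show (0 : ℝ) < n + 2 by linarith)
    push_cast at h2
    linarith
  have hmaj : (n : ℝ) ^ 2 * expMajorant r (n : ℝ)⁻¹ =
      N * Real.log r + n * (r + 1) + 2 * (n + 1) := by
    rw [show (N : ℝ) = (n + 1) * (n + 2) / 2 by linarith, expMajorant]
    field_simp
    ring
  rw [scaledExtremal, ENNReal.mul_iSup]
  refine iSup_le fun P => ?_
  rw [← ENNReal.ofReal_mul (by positivity)]
  apply ENNReal.ofReal_le_ofReal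
  rw [inv_mul_le_iff₀ (by positivity), hmaj]
  by_cases h0 : alongGraph Complex.exp P z = 0
  · rw [h0, norm_zero, Real.log_zero]
    positivity
  have hb := norm_alongGraph_exp_le_of_unitPolys P.2 hN2 hr hz
  have hlog := Real.log_le_log (norm_pos_iff.2 h0) hb
  have hrN : r ^ N ≠ 0 := by positivity
  rw [Real.log_mul (Real.exp_ne_zero _) (mul_ne_zero hN0.ne' hrN), Real.log_exp,
    Real.log_mul hN0.ne' hrN, Real.log_pow] at hlog
  linarith

lemma eventuallyLocallyBounded_scaledExtremal_exp :
    EventuallyLocallyBounded (scaledExtremal Complex.exp) := by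
  intro R
  set r := max 1 R with hr
  have hr1 : 1 ≤ r := le_max_left _ _
  refine ⟨ENNReal.ofReal (expMajorant r 1), ENNReal.ofReal_ne_top, ?_⟩
  filter_upwards [eventually_ge_atTop 1] with n hn z hz
  rw [mem_closedBall_zero_iff] at hz
  refine (scaledExtremal_exp_le hn hr1 (hz.trans (le_max_right _ _))).trans
    (ENNReal.ofReal_le_ofReal ?_)
  have h1 : (n : ℝ)⁻¹ ≤ 1 := inv_le_one_of_one_le₀ (by exact_mod_cast hn)
  have hL := Real.log_nonneg hr1
  unfold expMajorant
  gcongr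

lemma limsupExtremal_exp_le (z : ℂ) :
    limsupExtremal Complex.exp z ≤ ENNReal.ofReal (1 / 2 * Real.posLog ‖z‖) := by
  have ht : Tendsto (fun n : ℕ => ENNReal.ofReal (expMajorant (max 1 ‖z‖) (n : ℝ)⁻¹)) atTop
      (𝓝 (ENNReal.ofReal (expMajorant (max 1 ‖z‖) 0))) := by
    have hc : Continuous (expMajorant (max 1 ‖z‖)) := by
      unfold expMajorant
      fun_prop
    exact ENNReal.tendsto_ofReal ((hc.tendsto 0).comp tendsto_inv_atTop_nhds_zero_nat)
  have h0 : expMajorant (max 1 ‖z‖) 0 = 1 / 2 * Real.posLog ‖z‖ := by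
    rw [Real.posLog_eq_log_max_one (norm_nonneg z), expMajorant]
    ring
  rw [← h0, ← ht.limsup_eq]
  refine limsup_le_limsup ?_
  filter_upwards [eventually_ge_atTop 1] with n hn
  exact scaledExtremal_exp_le hn (le_max_left _ _) (le_max_right _ _)

lemma extremalStar_exp (z : ℂ) :
    extremalStar Complex.exp z = (((1 / 2) * Real.posLog ‖z‖ : ℝ) : EReal) := by
  have hb := eventuallyLocallyBounded_scaledExtremal_exp
  have hupper := regExtremal_le_posLog limsupExtremal_exp_le
  suffices h : regExtremal Complex.exp z = ENNReal.ofReal (1 / 2 * Real.posLog ‖z‖) by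
    rw [extremalStar_eq_coe, h, EReal.coe_ennreal_ofReal,
      max_eq_left (mul_nonneg (by norm_num) Real.posLog_nonneg)]
  have hposLog : ∀ w : ℂ, 1 < ‖w‖ → Real.posLog ‖w‖ = Real.log ‖w‖ := fun w hw =>
    Real.posLog_eq_log (by rw [abs_norm]; exact hw.le)
  rcases le_or_gt ‖z‖ 1 with hz | hz
  · have h0 : Real.posLog ‖z‖ = 0 := (Real.posLog_eq_zero_iff _).2 (by rwa [abs_norm])
    have h := hupper z
    rw [h0, mul_zero, ENNReal.ofReal_zero] at h ⊢
    exact nonpos_iff_eq_zero.1 h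
  · obtain ⟨c, hc, hlow, -⟩ :=
      exists_mem_sphere_le_regExtremal isEntireTranscendental_exp hb hz.le
    rw [mem_sphere_zero_iff_norm] at hc
    have hc1 : 1 < ‖c‖ := by rwa [hc]
    have hle : ∀ w : ℂ, 1 < ‖w‖ →
        regExtremal Complex.exp w ≤ ENNReal.ofReal (1 / 2 * Real.log ‖w‖) := fun w hw => by
      rw [← hposLog w hw]; exact hupper w
    rw [hposLog z hz]
    refine eq_log_norm_of_eq (subMean_regExtremal Complex.differentiable_exp hb)
      (upperSemicontinuous_regExtremal _) (by norm_num) hle hc1 ?_ hz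
    exact le_antisymm (hle c hc1) (by rwa [hc])

/-! ### Consequences of the growth hypothesis -/

/-- A fixed disk lies within the admissible radius only once `ρ n` has passed it, which is why
boundedness is required only eventually in n. -/
lemma eventuallyLocallyBounded_of_growth {f : ℂ → ℂ} {C : ℝ} {ρ : ℕ → ℝ}
    (hρ : Tendsto ρ atTop atTop)
    (h : ∀ n : ℕ, 1 ≤ n → ∀ r : ℝ, 1 ≤ r → r ≤ ρ n →
      growth f n r ≤ ((C * (n : ℝ) ^ 2 * Real.log r : ℝ) : EReal)) :
    EventuallyLocallyBounded (scaledExtremal f) := by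
  intro R
  refine ⟨ENNReal.ofReal (|C| * Real.posLog R), ENNReal.ofReal_ne_top, ?_⟩
  filter_upwards [eventually_ge_atTop 1, hρ.eventually_ge_atTop (max 1 R)] with n hn hρn z hz
  rw [mem_closedBall_zero_iff] at hz
  refine (scaledExtremal_le_of_growth h hn ((max_le_max le_rfl hz).trans hρn)).trans
    (ENNReal.ofReal_le_ofReal ?_)
  have h1 := Real.posLog_le_posLog (norm_nonneg z) hz
  have h2 : 0 ≤ Real.posLog ‖z‖ := Real.posLog_nonneg
  exact mul_le_mul (le_abs_self C) h1 h2 (abs_nonneg C)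

lemma limsupExtremal_le_of_growth {f : ℂ → ℂ} {C : ℝ} {ρ : ℕ → ℝ}
    (hρ : Tendsto ρ atTop atTop)
    (h : ∀ n : ℕ, 1 ≤ n → ∀ r : ℝ, 1 ≤ r → r ≤ ρ n →
      growth f n r ≤ ((C * (n : ℝ) ^ 2 * Real.log r : ℝ) : EReal)) (z : ℂ) :
    limsupExtremal f z ≤ ENNReal.ofReal (C * Real.posLog ‖z‖) := by
  refine limsup_le_of_le (h := ?_)
  filter_upwards [eventually_ge_atTop 1, hρ.eventually_ge_atTop (max 1 ‖z‖)] with n hn hρn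
  exact scaledExtremal_le_of_growth h hn hρn

end TransMeasure

theorem propositionP :
    (∀ (f : ℂ → ℂ) (C : ℝ) (ρ : ℕ → ℝ),
      TransMeasure.IsEntireTranscendental f →
      Monotone ρ → Tendsto ρ atTop atTop →
      (∀ n : ℕ, 1 ≤ n → ∀ r : ℝ, 1 ≤ r → r ≤ ρ n →
        TransMeasure.growth f n r ≤ ((C * (n : ℝ) ^ 2 * Real.log r : ℝ) : EReal)) →
      TransMeasure.IsSubharmonic (TransMeasure.extremalStar f) ∧
      (∀ z : ℂ, 0 ≤ TransMeasure.extremalStar f z) ∧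
      (∀ z ∈ closedBall (0 : ℂ) 1, TransMeasure.extremalStar f z = 0) ∧
      (∀ r : ℝ, 1 ≤ r → ∃ M : ℝ,
        IsGreatest (TransMeasure.extremalStar f '' sphere (0 : ℂ) r) (M : EReal) ∧
        (1 / 2) * Real.log r ≤ M ∧ M ≤ C * Real.log r)) ∧
    (∀ z : ℂ, TransMeasure.extremalStar Complex.exp z
        = (((1 / 2) * Real.posLog ‖z‖ : ℝ) : EReal)) := by
  exact ⟨fun f C ρ hf _ hρ h => TransMeasure.extremalStar_properties hf
    (TransMeasure.eventuallyLocallyBounded_of_growth hρ h)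
    (TransMeasure.limsupExtremal_le_of_growth hρ h), TransMeasure.extremalStar_exp⟩
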